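/- Let $\mathcal{T}$ be a triangulated category with suspension $\Sigma$. Its graded center $Z^*(\mathcal{T})$ has as degree $n$ component the natural transformations $f\colon \mathrm{Id}\to\Sigma^n$ with $f_{\Sigma X}=(-1)^n\Sigma f_X$ for all $X$. Let $R=\bigoplus_{i\ge 0}R_i$ be a graded-commutative ring (that is, $rs=(-1)^{|r||s|}sr$ for homogeneous $r,s$) acting centrally on $\mathcal{T}$, i.e. equipped with a homomorphism of graded rings $R\to Z^*(\mathcal{T})$; write $\varphi_X(r)\colon X\to\Sigma^{|r|}X$ for the value at $X$ of the image of a homogeneous element $r$. For objects $X,Y$, the graded group $\mathrm{Hom}^*(X,Y)=\bigoplus_{i\in\mathbb{Z}}\mathrm{Hom}_{\mathcal{T}}(X,\Sigma^iY)$ is a graded $R$-module via $r\cdot g=\Sigma^{m}\varphi_Y(r)\circ g$ for $g\colon X\to\Sigma^mY$, and $\mathrm{Hom}^{\ge n}(X,Y)$ denotes its submodule of elements supported in degrees $\ge n$. The module $\mathrm{Hom}^*(X,Y)$ is called eventually Noetherian of finite length if $\mathrm{Hom}^{\ge n_0}(X,Y)$ is a Noetherian $R$-module for some $n_0\in\mathbb{Z}$,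 and there is $n_0\in\mathbb{Z}$ such that the $R_0$-module $\mathrm{Hom}_{\mathcal{T}}(X,\Sigma^nY)$ has finite length for all $n\ge n_0$. Let $R^{\mathrm{ev}}=\bigoplus_{i\ge0}R_{2i}$. The complexity $\mathrm{cx}\,X$ is the Krull dimension (the dimension of the support) of the $R^{\mathrm{ev}}$-module $\mathrm{Hom}^{\ge n}(X,X)$ for $n\gg0$, equivalently the infimum of these dimensions over all $n\in\mathbb{Z}$, where the zero module is given dimension $0$. Let $X$ be an object such that $\mathrm{Hom}^*(X,X)$ is eventually Noetherian of finite length. If $\mathrm{cx}\,X\neq0$, then $\mathrm{cx}\,X$ is finite, and there exists a homogeneous element $r\in R$ of positive degree such that every Koszul object $X/\!\!/r$, i.e. every object fitting into a distinguished triangle $$X\xrightarrow{\varphi_X(r)}\Sigma^{|r|}X\to X/\!\!/r\to\Sigma X$$ (such an object exists and is unique up to isomorphism), satisfies $\mathrm{cx}(X/\!\!/r)=\mathrm{cx}\,X-1$. -/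

import Mathlib

open CategoryTheory CategoryTheory.Limits CategoryTheory.Pretriangulated DirectSum

universe v u w

noncomputable section

/-! ### Graded-commutative rings -/

section Rings

variable {R : Type w} [Ring R] (𝒜 : ℕ → AddSubgroup R)

/-- Graded commutativity: `r s = (-1)^{|r||s|} s r` for homogeneous `r`, `s`. -/
class IsGradedCommutative : Prop where
  comm : ∀ (i j : ℕ) (r s : R), r ∈ 𝒜 i → s ∈ 𝒜 j → r * s = (-1) ^ (i * j) * (s * r)

variable [GradedRing 𝒜]

/-- The subring `R^ev = ⨁ R_{2i}`: all homogeneous components of odd degree vanish. -/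
def evenSubring : Subring R where
  carrier := {r | ∀ i : ℕ, Odd i → (DirectSum.decompose 𝒜 r i : R) = 0}
  zero_mem' := by intro i _; simp
  one_mem' := by
    intro i hi
    have h0 : i ≠ 0 := by rintro rfl; simp at hi
    exact DirectSum.decompose_of_mem_ne 𝒜 SetLike.GradedOne.one_mem h0.symm
  add_mem' := by
    intro a b ha hb i hi
    simp [DirectSum.decompose_add, ha i hi, hb i hi]
  neg_mem' := by
    intro a ha i hi
    have h : DirectSum.decompose 𝒜 a i = 0 := Subtype.ext (ha i hi)
    have h' : DirectSum.decompose 𝒜 (-a) i = -DirectSum.decompose 𝒜 a i := by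
      rw [DirectSum.decompose_neg]; rfl
    rw [h', h]; simp
  mul_mem' := by
    classical
    intro a b ha hb i hi
    rw [DirectSum.decompose_mul, DirectSum.coe_mul_apply]
    refine Finset.sum_eq_zero fun p hp => ?_
    have hp2 : p.1 + p.2 = i := (Finset.mem_filter.mp hp).2
    rcases Nat.even_or_odd p.1 with h1 | h1
    · have h2 : Odd p.2 := by
        rw [← hp2] at hi
        by_contra h
        exact (Nat.not_odd_iff_even.mpr (h1.add (Nat.not_odd_iff_even.mp h))) hi
      rw [hb _ h2, mul_zero]
    · rw [ha _ h1, zero_mul]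

instance evenSubring.instCommRing [IsGradedCommutative 𝒜] : CommRing (evenSubring 𝒜) :=
  { (inferInstance : Ring (evenSubring 𝒜)) with
    mul_comm := by
      classical
      rintro ⟨a, ha⟩ ⟨b, hb⟩
      apply Subtype.ext
      change a * b = b * a
      rw [← DirectSum.sum_support_decompose 𝒜 a, ← DirectSum.sum_support_decompose 𝒜 b,
        Finset.sum_mul_sum, Finset.sum_mul_sum, Finset.sum_comm]
      refine Finset.sum_congr rfl fun j _ => Finset.sum_congr rfl fun i _ => ?_
      rcases Nat.even_or_odd i with h1 | h1
      · rw [IsGradedCommutative.comm (𝒜 := 𝒜) i j _ _ (SetLike.coe_mem _) (SetLike.coe_mem _),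
          (h1.mul_right j).neg_one_pow, one_mul]
      · rw [ha i h1, zero_mul, mul_zero] }

end Rings

/-! ### The graded center and central actions -/

section Center

variable (C : Type u) [Category.{v} C] [Preadditive C] [HasShift C ℤ]
  [∀ n : ℤ, (shiftFunctor C n).Additive]

/-- The degree `n` component of the graded center: natural transformations
`f : Id ⟶ Σⁿ` with `f_{ΣX} = (-1)ⁿ Σ f_X`, where `ΣⁿΣX` and `ΣΣⁿX` are identified by the
canonical isomorphism. -/
def gradedCenter (n : ℤ) : AddSubgroup (𝟭 C ⟶ shiftFunctor C n) where
  carrier := {f | ∀ X : C, f.app (X⟦(1 : ℤ)⟧) =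
    n.negOnePow • ((f.app X)⟦(1 : ℤ)⟧' ≫ (shiftComm X n (1 : ℤ)).hom)}
  zero_mem' := by intro X; simp
  add_mem' := by
    intro f g hf hg X
    rw [NatTrans.app_add, hf X, hg X, NatTrans.app_add, Functor.map_add,
      Preadditive.add_comp, smul_add]
  neg_mem' := by
    intro f hf X
    rw [NatTrans.app_neg, hf X, NatTrans.app_neg, Functor.map_neg,
      Preadditive.neg_comp, smul_neg]

variable {C}

/-- The unit of the graded center, `Id ≅ Σ⁰`. -/
def gradedCenter.one (n : ℤ) (hn : n = 0) : gradedCenter C n :=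
  ⟨(shiftFunctorZero' C n hn).inv, by
    subst hn
    intro X
    have k : (shiftFunctorComm C (0 : ℤ) (1 : ℤ)).hom.app X =
        (shiftFunctorComm C (1 : ℤ) (0 : ℤ)).inv.app X := by
      rw [← shiftFunctorComm_symm C (0 : ℤ) (1 : ℤ)]; rfl
    simp only [shiftComm, Iso.app_hom, k, Int.negOnePow_zero, one_smul]
    rw [← cancel_mono ((shiftFunctorComm C (1 : ℤ) (0 : ℤ)).hom.app X), Category.assoc,
      Iso.inv_hom_id_app, shiftFunctorComm_zero_hom_app]
    simp [shiftFunctorZero']⟩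

/-- The product of the graded center: for `f` and `g` in degrees `m` and `n`, the product `fg` is
`X ⟶ ΣⁿX ⟶ Σᵐ⁺ⁿX`, first `g_X` and then `Σⁿ f_X`. -/
def gradedCenter.mul {m n k : ℤ} (f : gradedCenter C m) (g : gradedCenter C n) (h : m + n = k) :
    gradedCenter C k :=
  ⟨{ app := fun X =>
      ShiftedHom.comp (X := X) (Y := X) (Z := X) (g.1.app X) (f.1.app X) h
     naturality := by
      intro X Y p
      have hg := g.1.naturality p
      have hf := f.1.naturality p
      dsimp at hg hf
      dsimp [ShiftedHom.comp]
      rw [reassoc_of% hg, ← Functor.map_comp_assoc, hf, Functor.map_comp_assoc]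
      have hs := (shiftFunctorAdd' C m n k h).inv.naturality p
      dsimp at hs
      simp [hs] }, by
    subst h
    intro X
    have hf' := f.2 X
    have hg' := g.2 X
    dsimp [ShiftedHom.comp]
    rw [hf', hg', Int.negOnePow_add]
    have key := shiftFunctorComm_hom_app_comp_shift_shiftFunctorAdd_hom_app (C := C) (1 : ℤ) m n X
    rw [Functor.map_units_smul]
    simp only [Linear.units_smul_comp, Linear.comp_units_smul, smul_smul, Functor.map_comp,
      Category.assoc]
    congr 1
    have nat := (shiftFunctorComm C n (1 : ℤ)).hom.naturality (f.1.app X)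
    dsimp at nat
    simp only [shiftComm, Iso.app_hom]
    congr 1
    rw [shiftFunctorAdd'_eq_shiftFunctorAdd, ← reassoc_of% nat]
    congr 1
    have a (i : ℤ) (Y : C) : (shiftFunctorComm C i (1 : ℤ)).hom.app Y =
        (shiftFunctorComm C (1 : ℤ) i).inv.app Y := by
      rw [← shiftFunctorComm_symm C i (1 : ℤ)]; rfl
    rw [← cancel_mono ((shiftFunctorAdd C m n).hom.app (X⟦(1 : ℤ)⟧)),
      ← cancel_epi (((shiftFunctorAdd C m n).hom.app X)⟦(1 : ℤ)⟧'), a, a, a]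
    have key' : ((shiftFunctorAdd C m n).hom.app X)⟦(1 : ℤ)⟧' =
        (shiftFunctorComm C (1 : ℤ) (m + n)).inv.app X ≫
          (shiftFunctorAdd C m n).hom.app (X⟦(1 : ℤ)⟧) ≫
            ((shiftFunctorComm C 1 m).hom.app X)⟦n⟧' ≫
              (shiftFunctorComm C 1 n).hom.app (X⟦m⟧) := by
      rw [← key]; simp
    rw [key']
    simp
    rw [← reassoc_of% key, ← Functor.map_comp_assoc]
    simp⟩

variable {R : Type w} [Ring R] (𝒜 : ℕ → AddSubgroup R) [GradedRing 𝒜]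

variable (C) in
/-- A central action of the graded ring `R` on `C`: a homomorphism of graded rings from `R` to the
graded center, given degree by degree. -/
structure CentralAction where
  toCenter : ∀ n : ℕ, 𝒜 n →+ gradedCenter C (n : ℤ)
  map_one : toCenter 0 ⟨1, SetLike.GradedOne.one_mem⟩ =
    gradedCenter.one ((0 : ℕ) : ℤ) Nat.cast_zero
  map_mul : ∀ (m n : ℕ) (r : 𝒜 m) (s : 𝒜 n),
    toCenter (m + n) ⟨r.1 * s.1, SetLike.GradedMul.mul_mem r.2 s.2⟩ =
      gradedCenter.mul (toCenter m r) (toCenter n s) (Nat.cast_add m n).symm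

namespace CentralAction

variable {𝒜} (α : CentralAction C 𝒜)

/-- `φ_X(r) : X ⟶ Σ^{d} X` for `r` homogeneous of degree `d`. -/
def phi (X : C) {d : ℕ} (r : 𝒜 d) : X ⟶ X⟦(d : ℤ)⟧ := (α.toCenter d r).1.app X

/-- The graded group `Hom^*(X,Y) = ⨁_{i ∈ ℤ} Hom(X, Σⁱ Y)`. -/
def HomStar (_ : CentralAction C 𝒜) (X Y : C) : Type v := ⨁ i : ℤ, ShiftedHom X Y i

instance (X Y : C) : AddCommGroup (α.HomStar X Y) :=
  inferInstanceAs (AddCommGroup (⨁ i : ℤ, ShiftedHom X Y i))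

/-- The inclusion of `Hom(X, Σⁱ Y)` into `Hom^*(X,Y)`. -/
def of (X Y : C) (i : ℤ) : ShiftedHom X Y i →+ α.HomStar X Y :=
  DirectSum.of (fun i : ℤ => ShiftedHom X Y i) i

/-- The component of degree `i` of an element of `Hom^*(X,Y)`. -/
def component {X Y : C} (f : α.HomStar X Y) (i : ℤ) : X ⟶ Y⟦i⟧ :=
  (show ⨁ i : ℤ, ShiftedHom X Y i from f) i

variable {α} in
lemma addHom_ext {X Y : C} {A : Type*} [AddCommMonoid A] {f g : α.HomStar X Y →+ A}
    (h : ∀ i (x : ShiftedHom X Y i), f (α.of X Y i x) = g (α.of X Y i x)) : f = g :=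
  DirectSum.addHom_ext h

lemma of_comp_eq {X Y Z : C} {a b c c' : ℤ} (f : ShiftedHom X Y a) (g : ShiftedHom Y Z b)
    (h : b + a = c) (h' : b + a = c') :
    α.of X Z c (f.comp g h) = α.of X Z c' (f.comp g h') := by
  subst h h'; rfl

/-- Left multiplication by a homogeneous element `r` of degree `d`: it sends
`g : X ⟶ Σⁱ Y` to `X ⟶ ΣⁱY ⟶ Σ^{d+i}Y`, first `g` and then `Σⁱ φ_Y(r)`. -/
def homLeftMul (X Y : C) {d : ℕ} (r : 𝒜 d) : α.HomStar X Y →+ α.HomStar X Y :=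
  DirectSum.toAddMonoid (β := fun i : ℤ => ShiftedHom X Y i) fun i : ℤ =>
    (α.of X Y ((d : ℤ) + i)).comp
      { toFun := fun g : ShiftedHom X Y i => g.comp (α.phi Y r) rfl
        map_zero' := ShiftedHom.zero_comp _ _ _ _
        map_add' := fun g g' => ShiftedHom.add_comp g g' _ _ }

lemma homLeftMul_of (X Y : C) {d : ℕ} (r : 𝒜 d) (i : ℤ) (g : ShiftedHom X Y i) :
    α.homLeftMul X Y r (α.of X Y i g) =
      α.of X Y ((d : ℤ) + i) (g.comp (α.phi Y r) rfl) :=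
  DirectSum.toAddMonoid_of (β := fun i : ℤ => ShiftedHom X Y i) _ i g

/-- Left multiplication by homogeneous elements of degree `d`, additive in the element. -/
def leftMul (X Y : C) (d : ℕ) : 𝒜 d →+ AddMonoid.End (α.HomStar X Y) where
  toFun r := α.homLeftMul X Y r
  map_zero' := by
    refine addHom_ext fun i x => (α.homLeftMul_of X Y 0 i x).trans ?_
    have h : α.phi Y (0 : 𝒜 d) = 0 := by simp [phi]
    rw [h, ShiftedHom.comp_zero, _root_.map_zero]
    rfl
  map_add' r s := by
    refine addHom_ext fun i x => (α.homLeftMul_of X Y (r + s) i x).trans ?_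
    have h : α.phi Y (r + s) = α.phi Y r + α.phi Y s := by simp [phi]
    rw [h, ShiftedHom.comp_add, _root_.map_add, ← homLeftMul_of, ← homLeftMul_of]
    rfl

lemma leftMul_of (X Y : C) (d : ℕ) (r : 𝒜 d) (i : ℤ) (g : ShiftedHom X Y i) :
    α.leftMul X Y d r (α.of X Y i g) =
      α.of X Y ((d : ℤ) + i) (g.comp (α.phi Y r) rfl) :=
  α.homLeftMul_of X Y r i g

/-- The action of `R` on `Hom^*(X,Y)` by left multiplication. -/
def toEnd (X Y : C) : R →+* AddMonoid.End (α.HomStar X Y) :=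
  (DirectSum.toSemiring (α.leftMul X Y)
    (by
      refine addHom_ext fun i x => ?_
      refine (α.leftMul_of X Y 0 _ i x).trans ?_
      change _ = α.of X Y i x
      have h1 : α.phi Y (GradedMonoid.GOne.one (A := fun i => 𝒜 i) : 𝒜 0) =
          ShiftedHom.mk₀ ((0 : ℕ) : ℤ) Nat.cast_zero (𝟙 Y) := by
        refine (congrArg (fun z : gradedCenter C ((0 : ℕ) : ℤ) => z.1.app Y) α.map_one).trans ?_
        exact (Category.id_comp _).symm
      rw [h1, α.of_comp_eq _ _ rfl (show ((0 : ℕ) : ℤ) + i = i by simp),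
        ShiftedHom.comp_mk₀_id])
    (by
      intro m n r s
      refine addHom_ext fun i x => ?_
      refine (α.leftMul_of X Y (m + n) _ i x).trans ?_
      refine Eq.trans ?_ (congrArg (α.leftMul X Y m r) (α.leftMul_of X Y n s i x)).symm
      rw [leftMul_of]
      have h1 : α.phi Y (GradedMonoid.GMul.mul (A := fun i => 𝒜 i) r s : 𝒜 (m + n)) =
          ShiftedHom.comp (X := Y) (Y := Y) (Z := Y) (α.phi Y s) (α.phi Y r)
            (Nat.cast_add m n).symm :=
        congrArg (fun z : gradedCenter C ((m + n : ℕ) : ℤ) => z.1.app Y) (α.map_mul m n r s)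
      rw [h1, ← ShiftedHom.comp_assoc x (α.phi Y s) (α.phi Y r) rfl (Nat.cast_add m n).symm
        (by push_cast; ring)]
      exact α.of_comp_eq _ _ _ _)).comp
  (DirectSum.decomposeRingEquiv 𝒜 : R ≃+* ⨁ i, 𝒜 i).toRingHom

instance (X Y : C) : Module R (α.HomStar X Y) := Module.compHom _ (α.toEnd X Y)

/-- On homogeneous elements the `R`-module structure is left multiplication via `φ_Y`. -/
lemma smul_of (X Y : C) (d : ℕ) (r : 𝒜 d) (i : ℤ) (g : ShiftedHom X Y i) :
    (r : R) • α.of X Y i g = α.of X Y ((d : ℤ) + i) (g.comp (α.phi Y r) rfl) := by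
  rw [← leftMul_of]
  change DirectSum.toAddMonoid (α.leftMul X Y) (DirectSum.decompose 𝒜 (r : R)) _ = _
  rw [DirectSum.decompose_coe, DirectSum.toAddMonoid_of]

lemma component_add {X Y : C} (f g : α.HomStar X Y) (i : ℤ) :
    α.component (f + g) i = α.component f i + α.component g i := rfl

lemma component_zero {X Y : C} (i : ℤ) : α.component (0 : α.HomStar X Y) i = 0 := rfl

lemma component_of_ne {X Y : C} {i j : ℤ} (g : ShiftedHom X Y i) (h : i ≠ j) :
    α.component (α.of X Y i g) j = 0 :=
  DirectSum.of_eq_of_ne _ _ _ h.symm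

lemma component_smul_eq_zero {X Y : C} {d : ℕ} (r : 𝒜 d) (f : α.HomStar X Y) (j : ℤ)
    (hf : ∀ i : ℤ, (d : ℤ) + i = j → α.component f i = 0) :
    α.component ((r : R) • f) j = 0 := by
  classical
  let ev (j : ℤ) : α.HomStar X Y →+ ShiftedHom X Y j :=
    { toFun := fun f => α.component f j, map_zero' := rfl, map_add' := fun _ _ => rfl }
  change ev j _ = 0
  have key : f = ∑ i ∈ DFinsupp.support (show ⨁ i : ℤ, ShiftedHom X Y i from f),
      α.of X Y i (α.component f i) :=
    (DirectSum.sum_support_of (show ⨁ i : ℤ, ShiftedHom X Y i from f)).symm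
  rw [key, Finset.smul_sum, map_sum]
  refine Finset.sum_eq_zero fun i _ => ?_
  rw [smul_of]
  by_cases h : (d : ℤ) + i = j
  · rw [hf i h, ShiftedHom.zero_comp, map_zero, map_zero]
  · exact α.component_of_ne _ h

/-- The `R`-submodule `Hom^{≥ n}(X,Y)` of `Hom^*(X,Y)`. -/
def homGE (X Y : C) (n : ℤ) : Submodule R (α.HomStar X Y) where
  carrier := {f | ∀ i : ℤ, i < n → α.component f i = 0}
  zero_mem' := fun _ _ => rfl
  add_mem' := by
    intro f g hf hg i hi
    rw [component_add, hf i hi, hg i hi, add_zero]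
  smul_mem' := by
    classical
    intro r f hf j hj
    let ev : α.HomStar X Y →+ ShiftedHom X Y j :=
      { toFun := fun f => α.component f j, map_zero' := rfl, map_add' := fun _ _ => rfl }
    change ev _ = 0
    rw [← DirectSum.sum_support_decompose 𝒜 r, Finset.sum_smul, map_sum]
    refine Finset.sum_eq_zero fun d _ => ?_
    exact α.component_smul_eq_zero _ f j fun i hi => hf i (by omega)

/-- `Hom(X, Σⁿ Y)` as a module over `R_0`, namely as the degree `n` part of `Hom^*(X,Y)`. -/
def homDegree (X Y : C) (n : ℤ) :
    Submodule (SetLike.GradeZero.subring 𝒜) (α.HomStar X Y) where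
  carrier := {f | ∀ i : ℤ, i ≠ n → α.component f i = 0}
  zero_mem' := fun _ _ => rfl
  add_mem' := by
    intro f g hf hg i hi
    rw [component_add, hf i hi, hg i hi, add_zero]
  smul_mem' := by
    intro r f hf j hj
    exact α.component_smul_eq_zero (d := 0) ⟨r.1, r.2⟩ f j
      fun i hi => hf i (by rintro rfl; simp at hi; exact hj hi.symm)

/-- `Hom^*(X,Y)` is an eventually Noetherian `R`-module. -/
def EventuallyNoetherian (X Y : C) : Prop :=
  ∃ n₀ : ℤ, IsNoetherian R (α.homGE X Y n₀)

/-- `Hom^*(X,Y)` is an eventually Noetherian `R`-module of finite length. -/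
def EventuallyNoetherianFL (X Y : C) : Prop :=
  α.EventuallyNoetherian X Y ∧
    ∃ n₀ : ℤ, ∀ n : ℤ, n₀ ≤ n →
      IsFiniteLength (SetLike.GradeZero.subring 𝒜) (α.homDegree X Y n)

/-- The complexity of the pair `(X,Y)`: the Krull dimension over `R^ev` of `Hom^{≥ n}(X,Y)` for
`n ≫ 0`. The dimension does not increase with `n`, so that its value for `n ≫ 0` is
the infimum over all `n`. The zero module is given dimension `0`. -/
def cxPair [IsGradedCommutative 𝒜] (X Y : C) : ℕ∞ :=
  ⨅ n : ℤ, (Module.supportDim (evenSubring 𝒜) (α.homGE X Y n)).unbotD 0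

/-- The complexity of the object `X`. -/
def cx [IsGradedCommutative 𝒜] (X : C) : ℕ∞ := α.cxPair X X

/-- `K` is a Koszul object `X//r`: there is a distinguished triangle
`X ⟶ Σ^{d} X ⟶ K ⟶ Σ X` whose first morphism is `φ_X(r)`. -/
def IsKoszulObject [HasZeroObject C] [Pretriangulated C] (X : C) {d : ℕ} (r : 𝒜 d) (K : C) :
    Prop :=
  ∃ (g : X⟦(d : ℤ)⟧ ⟶ K) (h : K ⟶ X⟦(1 : ℤ)⟧), Triangle.mk (α.phi X r) g h ∈ distTriang C

end CentralAction

end Center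

end

/-!
Put `A = R^ev` and let `I` be the annihilator in `A` of `Hom^{≥ n}(X,X)`, a homogeneous ideal. For
`n ≫ 0` the module `Hom^{≥ n}(X,X)` is Noetherian over `A`, because `R` acts on its even and odd
parts compatibly with the parity grading, and `(A/I)₀` is Artinian, since it acts faithfully on the
finitely many components of finite length that contain homogeneous generators. Hence the primes
over `I` containing the irrelevant ideal are maximal, `A/I` is finite over a subring generated over
`(A/I)₀` by as many elements as it takes to cut out the irrelevant ideal up to radical, and an
`r ∈ A` of positive degree that avoids the minimal primes over `I` not containing the irrelevant
ideal lowers the dimension by exactly one.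

It remains to compare, for `K = X//r`, the supports of `Hom^{≥ m}(K,K)` and `Hom^{≥ n}(X,X)/r`.
Exactness of the triangle shows that `r²` and the fourth powers of homogeneous elements of `I`
annihilate `Hom^{≥ m}(K,K)` for `m ≫ 0`, so the first support is contained in the second.
Conversely, if a homogeneous `b` vanishes on `K`, then `b` factors through `r` on all shifts of
`X`, whence `b` annihilates `Hom^{≥ n}(X,X)/r`. So the annihilator of a multiple `φ_K(s)` of the
identity lies in every prime of the second support that does not contain `s`, and this catches all
primes of the second support except those containing the irrelevant ideal, which are maximal.
-/

noncomputable section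

/-! ### Krull dimension of ordered sets -/

section KrullDim

variable {P : Type*} [Preorder P]

lemma krullDim_add_one_le_of_forall_isMax_or_exists_lt {s t : Set P} (hts : t ⊆ s)
    (hs : 1 ≤ Order.krullDim s) (h : ∀ x ∈ t, IsMax x ∨ ∃ y ∈ s, y < x) :
    Order.krullDim t + 1 ≤ Order.krullDim s := by
  rcases isEmpty_or_nonempty t with _ | _
  · rw [Order.krullDim_eq_bot, WithBot.bot_add]
    exact bot_le
  have hlength (l : LTSeries t) : ((l.length + 1 : ℕ) : WithBot ℕ∞) ≤ Order.krullDim s := by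
    rcases h _ l.head.2 with hmax | ⟨y, hy, hlt⟩
    · have hzero : l.length = 0 := by
        by_contra hne
        exact hmax.not_lt (l.strictMono (Fin.lt_def.mpr (Nat.pos_of_ne_zero hne)) :
          l.head < l.last)
      rwa [hzero, zero_add, Nat.cast_one]
    · exact Order.le_krullDim_iff.mpr
        ⟨(l.map (Set.inclusion hts) fun _ _ hab => hab).cons ⟨y, hy⟩ hlt, RelSeries.cons_length ..⟩
  rw [Order.krullDim_eq_iSup_length]
  generalize Order.krullDim s = d at hs hlength
  lift d to ℕ∞ using fun hd => by simp [hd] at hs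
  norm_cast
  rw [ENat.iSup_add]
  exact iSup_le fun l => by exact_mod_cast hlength l

lemma unbotD_krullDim_le_of_forall_isMax_or_mem {s t : Set P} (ht : IsUpperSet t)
    (h : ∀ x ∈ s, IsMax x ∨ x ∈ t) :
    (Order.krullDim s).unbotD 0 ≤ (Order.krullDim t).unbotD 0 := by
  refine (WithBot.unbotD_le_iff fun _ => zero_le).mpr (iSup_le fun l => ?_)
  rcases Nat.eq_zero_or_pos l.length with hzero | hpos
  · rw [hzero]
    exact WithBot.coe_le_coe.mpr (zero_le)
  have hhead : (l.head : P) ∈ t := (h _ l.head.2).resolve_left fun hmax =>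
    hmax.not_lt (l.strictMono (Fin.lt_def.mpr hpos) : l.head < l.last)
  let l' : LTSeries t :=
    ⟨l.length, fun i => ⟨l i, ht (l.strictMono.monotone (Fin.zero_le i)) hhead⟩, l.step⟩
  have hlength : (l.length : WithBot ℕ∞) ≤ Order.krullDim t :=
    Order.LTSeries.length_le_krullDim l'
  generalize Order.krullDim t = d at hlength
  lift d to ℕ∞ using fun hd => by simp [hd] at hlength
  exact hlength

end KrullDim

section RingTheory

lemma ringKrullDim_le_of_isIntegral (S T : Type*) [CommRing S] [CommRing T] [Algebra S T]
    [Algebra.IsIntegral S T] : ringKrullDim T ≤ ringKrullDim S :=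
  Order.krullDim_le_of_strictMono (PrimeSpectrum.comap (algebraMap S T)) fun _ _ hpq =>
    Ideal.IsIntegral.comap_lt_comap hpq

lemma isArtinianRing_of_surjective_of_smul_eq_zero {S B M : Type*} [Ring S] [CommRing B]
    [AddCommGroup M] [Module S M] [IsArtinian S M] (f : S →+* B) (hf : Function.Surjective f)
    (m : M) (hm : ∀ s : S, s • m = 0 → f s = 0) : IsArtinianRing B := by
  let F (J : Ideal B) : Submodule S M :=
    Submodule.map (LinearMap.toSpanSingleton S M m) (J.comap f)
  have smul_mem (J : Ideal B) (s : S) : s • m ∈ F J ↔ f s ∈ J := by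
    refine ⟨?_, fun hs => ⟨s, hs, rfl⟩⟩
    rintro ⟨s', hs', heq⟩
    have hsub : f (s' - s) = 0 := hm _ (by rw [sub_smul]; exact sub_eq_zero.mpr heq)
    rw [map_sub, sub_eq_zero] at hsub
    exact hsub ▸ hs'
  have hF : StrictMono F := strictMono_of_le_iff_le fun J J' =>
    ⟨fun h => Submodule.map_mono (Ideal.comap_mono h), fun h b hb => by
      obtain ⟨s, rfl⟩ := hf b
      exact (smul_mem J' s).mp (h ((smul_mem J s).mpr hb))⟩
  exact hF.wellFoundedLT

lemma isNoetherianRing_quotient_annihilator (S M : Type*) [CommRing S] [AddCommGroup M]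
    [Module S M] [IsNoetherian S M] : IsNoetherianRing (S ⧸ Module.annihilator S M) := by
  obtain ⟨n, g, hg⟩ := Module.Finite.exists_fin (R := S) (M := M)
  let f : S →ₗ[S] Fin n → M := LinearMap.pi fun i => LinearMap.toSpanSingleton S M (g i)
  have hker : Module.annihilator S M = LinearMap.ker f := by
    ext s
    rw [← Submodule.annihilator_top, ← hg]
    simp [f, Submodule.mem_annihilator_span, funext_iff]
  rw [hker]
  have : IsNoetherian S (S ⧸ LinearMap.ker f) :=
    isNoetherian_of_injective _ (LinearMap.ker_eq_bot.mp (Submodule.ker_liftQ_eq_bot' _ f rfl))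
  exact isNoetherian_of_tower S this

end RingTheory

section GradedRing

variable {A σ : Type*} [CommRing A] [SetLike σ A] [AddSubgroupClass σ A] (𝒜 : ℕ → σ)
  [GradedRing 𝒜]

open HomogeneousIdeal PrimeSpectrum

section PrimeAvoidance

lemma exists_homogeneous_notMem_of_not_irrelevant_le {p : Ideal A}
    (hp : ¬ (irrelevant 𝒜).toIdeal ≤ p) : ∃ d : ℕ, 0 < d ∧ ∃ x ∈ 𝒜 d, x ∉ p := by
  contrapose! hp
  exact (toIdeal_irrelevant_le 𝒜).mpr fun d hd x hx => hp d hd x hx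

lemma exists_homogeneous_notMem_of_degree_ge {p : Ideal A} [hprime : p.IsPrime]
    (hp : ¬ (irrelevant 𝒜).toIdeal ≤ p) (n : ℕ) : ∃ d : ℕ, n ≤ d ∧ ∃ x ∈ 𝒜 d, x ∉ p := by
  obtain ⟨d, hd, x, hx, hxp⟩ := exists_homogeneous_notMem_of_not_irrelevant_le 𝒜 hp
  exact ⟨n • d, Nat.le_mul_of_pos_right n hd, x ^ n, SetLike.pow_mem_graded n hx,
    fun h => hxp (hprime.mem_of_pow_mem n h)⟩

variable {𝒜} in
lemma exists_homogeneous_mem_notMem {p q : Ideal A} (hp : p.IsHomogeneous 𝒜) (hpq : ¬ p ≤ q) :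
    ∃ d : ℕ, ∃ x ∈ 𝒜 d, x ∈ p ∧ x ∉ q := by
  classical
  obtain ⟨y, hyp, hyq⟩ := SetLike.not_le_iff_exists.mp hpq
  contrapose! hyq
  rw [← sum_support_decompose 𝒜 y]
  exact sum_mem fun d _ => hyq d _ (SetLike.coe_mem _) (hp d hyp)

variable {T : Finset (Ideal A)}

lemma exists_homogeneous_notMem_forall_ne_mem (hprime : ∀ p ∈ T, p.IsPrime)
    (hhom : ∀ p ∈ T, p.IsHomogeneous 𝒜) (hanti : IsAntichain (· ≤ ·) (T : Set (Ideal A)))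
    (hirr : ∀ p ∈ T, ¬ (irrelevant 𝒜).toIdeal ≤ p) {p : Ideal A} (hp : p ∈ T) :
    ∃ d : ℕ, 0 < d ∧ ∃ x ∈ 𝒜 d, x ∉ p ∧ ∀ q ∈ T, q ≠ p → x ∈ q := by
  classical
  obtain ⟨e, he, z, hz, hzp⟩ := exists_homogeneous_notMem_of_not_irrelevant_le 𝒜 (hirr p hp)
  have hy : ∀ q ∈ T.erase p, ∃ d : ℕ, ∃ y ∈ 𝒜 d, y ∈ q ∧ y ∉ p := fun q hq =>
    exists_homogeneous_mem_notMem (hhom q (Finset.mem_of_mem_erase hq))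
      (hanti (Finset.mem_of_mem_erase hq) hp (Finset.ne_of_mem_erase hq))
  choose! d y hyd hyq hyp using hy
  have := hprime p hp
  refine ⟨e + ∑ q ∈ T.erase p, d q, by omega, z * ∏ q ∈ T.erase p, y q,
    SetLike.mul_mem_graded hz (SetLike.prod_mem_graded _ _ _ hyd), ?_, fun q hq hqp => ?_⟩
  · rw [Ideal.IsPrime.mul_mem_iff_mem_or_mem this, Ideal.IsPrime.prod_mem_iff]
    rintro (hmem | ⟨q, hq, hmem⟩)
    exacts [hzp hmem, hyp q hq hmem]
  · have hq' := Finset.mem_erase.mpr ⟨hqp, hq⟩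
    exact Ideal.mul_mem_left _ _ (Ideal.mem_of_dvd q (Finset.dvd_prod_of_mem y hq') (hyq q hq'))

lemma exists_homogeneous_forall_notMem (hprime : ∀ p ∈ T, p.IsPrime)
    (hhom : ∀ p ∈ T, p.IsHomogeneous 𝒜) (hanti : IsAntichain (· ≤ ·) (T : Set (Ideal A)))
    (hirr : ∀ p ∈ T, ¬ (irrelevant 𝒜).toIdeal ≤ p) :
    ∃ d : ℕ, 0 < d ∧ ∃ r ∈ 𝒜 d, ∀ p ∈ T, r ∉ p := by
  classical
  have hx := fun p (hp : p ∈ T) =>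
    exists_homogeneous_notMem_forall_ne_mem 𝒜 hprime hhom hanti hirr hp
  choose! d hd x hxd hxp hxq using hx
  have hpos (p : Ideal A) : 0 < ∏ q ∈ T.erase p, d q :=
    Finset.prod_pos fun q hq => hd q (Finset.mem_of_mem_erase hq)
  refine ⟨∏ p ∈ T, d p, Finset.prod_pos hd, ∑ p ∈ T, x p ^ ∏ q ∈ T.erase p, d q,
    sum_mem fun p hp => ?_, fun p hp hmem => ?_⟩
  · rw [← Finset.prod_erase_mul T d hp]
    exact SetLike.pow_mem_graded _ (hxd p hp)
  · have hothers : ∑ p' ∈ T.erase p, x p' ^ ∏ q ∈ T.erase p', d q ∈ p := sum_mem fun q hq =>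
      p.pow_mem_of_mem (hxq q (Finset.mem_of_mem_erase hq) p hp (Finset.ne_of_mem_erase hq).symm)
        _ (hpos q)
    rw [← Finset.add_sum_erase T _ hp, p.add_mem_iff_left hothers] at hmem
    exact hxp p hp ((hprime p hp).mem_of_pow_mem _ hmem)

variable {𝒜} in
lemma isHomogeneous_of_mem_minimalPrimes {J p : Ideal A} (hJ : J.IsHomogeneous 𝒜)
    (hp : p ∈ J.minimalPrimes) : p.IsHomogeneous 𝒜 := by
  have hle := Ideal.toIdeal_homogeneousCore_le 𝒜 p
  have hJcore : J ≤ (p.homogeneousCore 𝒜).toIdeal := by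
    rw [← hJ.toIdeal_homogeneousCore_eq_self]
    exact Ideal.homogeneousCore_mono 𝒜 hp.1.2
  exact (Ideal.IsHomogeneous.iff_eq 𝒜 p).mpr
    (hle.antisymm (hp.2 ⟨hp.1.1.homogeneousCore, hJcore⟩ hle))

variable {𝒜} in
lemma exists_homogeneous_notMem_minimalPrimes [IsNoetherianRing A] {J : Ideal A}
    (hJ : J.IsHomogeneous 𝒜) :
    ∃ d : ℕ, 0 < d ∧ ∃ r ∈ 𝒜 d, ∀ p ∈ J.minimalPrimes, ¬ (irrelevant 𝒜).toIdeal ≤ p → r ∉ p := by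
  have hfin : {p ∈ J.minimalPrimes | ¬ (irrelevant 𝒜).toIdeal ≤ p}.Finite :=
    (J.finite_minimalPrimes_of_isNoetherianRing A).subset (Set.sep_subset _ _)
  obtain ⟨d, hd, r, hr, hnot⟩ := exists_homogeneous_forall_notMem 𝒜 (T := hfin.toFinset)
    (fun p hp => (hfin.mem_toFinset.mp hp).1.1.1)
    (fun p hp => isHomogeneous_of_mem_minimalPrimes hJ (hfin.mem_toFinset.mp hp).1)
    (by
      rw [hfin.coe_toFinset]
      exact (setOfPred_minimal_antichain _).subset (Set.sep_subset _ _))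
    (fun p hp => (hfin.mem_toFinset.mp hp).2)
  exact ⟨d, hd, r, hr, fun p hp hirr => hnot p (hfin.mem_toFinset.mpr ⟨hp, hirr⟩)⟩

end PrimeAvoidance

section ZeroDimensional

lemma isMaximal_of_irrelevant_le [Ring.KrullDimLE 0 (𝒜 0)] {p : Ideal A} [p.IsPrime]
    (hp : (irrelevant 𝒜).toIdeal ≤ p) : p.IsMaximal := by
  let π := GradedRing.projZeroRingHom' 𝒜
  have hπ : Function.Surjective π := GradedRing.projZeroRingHom'_surjective 𝒜
  have hker : RingHom.ker π ≤ p := fun x hx =>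
    hp ((mem_irrelevant_iff 𝒜 x).mpr (congrArg Subtype.val hx))
  have hmax : (p.map π).IsMaximal :=
    Ring.krullDimLE_zero_iff.mp inferInstance _ (Ideal.map_isPrime_of_surjective hπ hker)
  rw [← sup_eq_left.mpr hker, ← Ideal.comap_map_of_surjective' π hπ p]
  exact Ideal.comap_isMaximal_of_surjective π hπ

variable {𝒜} in
lemma sup_irrelevant_ne_top {J : Ideal A} (hJ : J.IsHomogeneous 𝒜) (hne : J ≠ ⊤) :
    J ⊔ (irrelevant 𝒜).toIdeal ≠ ⊤ := by
  intro htop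
  obtain ⟨x, hx, y, hy, hxy⟩ := Submodule.mem_sup.mp ((Ideal.eq_top_iff_one _).mp htop)
  have hzero := congrArg (GradedRing.proj 𝒜 0) hxy
  rw [map_add, (mem_irrelevant_iff 𝒜 y).mp hy, add_zero, GradedRing.proj_apply,
    GradedRing.proj_apply, decompose_of_mem_same 𝒜 SetLike.GradedOne.one_mem] at hzero
  exact hne ((Ideal.eq_top_iff_one _).mpr (hzero ▸ hJ 0 hx))

variable {𝒜} in
lemma one_le_krullDim_zeroLocus {J p : Ideal A} (hJ : J.IsHomogeneous 𝒜) [hp : p.IsPrime]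
    (hJp : J ≤ p) (hirr : ¬ (irrelevant 𝒜).toIdeal ≤ p) :
    1 ≤ Order.krullDim (zeroLocus (J : Set A)) := by
  let q := p.homogeneousCore 𝒜
  have hq : q.toIdeal.IsPrime := hp.homogeneousCore
  have hJq : J ≤ q.toIdeal := by
    rw [← hJ.toIdeal_homogeneousCore_eq_self]
    exact Ideal.homogeneousCore_mono 𝒜 hJp
  obtain ⟨m, hm, hle⟩ :=
    Ideal.exists_le_maximal _ (sup_irrelevant_ne_top q.isHomogeneous hq.ne_top)
  have hlt : q.toIdeal < m := (le_sup_left.trans hle).lt_of_ne fun heq =>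
    hirr ((heq ▸ le_sup_right.trans hle).trans (Ideal.toIdeal_homogeneousCore_le 𝒜 p))
  exact Order.one_le_krullDim_iff.mpr
    ⟨⟨⟨_, hq⟩, hJq⟩, ⟨⟨m, hm.isPrime⟩, hJq.trans hlt.le⟩, hlt⟩

end ZeroDimensional

section Parameters

variable {𝒜} in
lemma exists_homogeneous_krullDim_zeroLocus_add_one_le [IsNoetherianRing A]
    [Ring.KrullDimLE 0 (𝒜 0)] {J : Ideal A} (hJ : J.IsHomogeneous 𝒜)
    (hdim : 1 ≤ Order.krullDim (zeroLocus (J : Set A))) :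
    ∃ d : ℕ, 0 < d ∧ ∃ r ∈ 𝒜 d,
      Order.krullDim (zeroLocus ((J ⊔ Ideal.span {r} : Ideal A) : Set A)) + 1 ≤
        Order.krullDim (zeroLocus (J : Set A)) := by
  obtain ⟨d, hd, r, hr, hnot⟩ := exists_homogeneous_notMem_minimalPrimes hJ
  refine ⟨d, hd, r, hr, krullDim_add_one_le_of_forall_isMax_or_exists_lt
    (zeroLocus_anti_mono_ideal le_sup_left) hdim fun p hp => or_iff_not_imp_left.mpr fun hmax => ?_⟩
  have hirr : ¬ (irrelevant 𝒜).toIdeal ≤ p.asIdeal := fun hle =>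
    hmax (isMax_iff.mpr (isMaximal_of_irrelevant_le 𝒜 hle))
  have hrp : r ∈ p.asIdeal := hp (Ideal.mem_sup_right (Ideal.mem_span_singleton_self r))
  obtain ⟨q, hq, hqp⟩ := Ideal.exists_minimalPrimes_le (le_sup_left.trans hp : J ≤ p.asIdeal)
  exact ⟨⟨q, hq.1.1⟩, hq.1.2, hqp.lt_of_ne fun heq =>
    hnot q hq (fun hle => hirr (hle.trans hqp)) (heq ▸ hrp)⟩

variable {𝒜} in
lemma exists_finset_irrelevant_le_radical [IsNoetherianRing A] [Ring.KrullDimLE 0 (𝒜 0)] {n : ℕ}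
    {J : Ideal A} (hJ : J.IsHomogeneous 𝒜) (hn : Order.krullDim (zeroLocus (J : Set A)) ≤ n) :
    ∃ t : Finset A, t.card ≤ n ∧ (∀ x ∈ t, ∃ d : ℕ, 0 < d ∧ x ∈ 𝒜 d) ∧
      (irrelevant 𝒜).toIdeal ≤ (J ⊔ Ideal.span t).radical := by
  classical
  by_cases hdim : 1 ≤ Order.krullDim (zeroLocus (J : Set A))
  · obtain ⟨d, hd, r, hr, hdrop⟩ := exists_homogeneous_krullDim_zeroLocus_add_one_le hJ hdim
    obtain ⟨n, rfl⟩ : ∃ m, n = m + 1 :=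
      Nat.exists_eq_succ_of_ne_zero fun h => by
        subst h
        exact absurd (hdim.trans hn) (by simp)
    have hJr : (J ⊔ Ideal.span {r}).IsHomogeneous 𝒜 :=
      hJ.sup (Ideal.homogeneous_span 𝒜 _ (by rintro _ rfl; exact ⟨d, hr⟩))
    obtain ⟨t, htcard, ht, hirr⟩ := exists_finset_irrelevant_le_radical (n := n) hJr
      (ENat.WithBot.add_le_add_one_right_iff.mp (hdrop.trans hn))
    refine ⟨insert r t, (Finset.card_insert_le r t).trans (by omega), ?_, ?_⟩
    · exact Finset.forall_mem_insert .. |>.mpr ⟨⟨d, hd, hr⟩, ht⟩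
    · rwa [Finset.coe_insert, Ideal.span_insert, ← sup_assoc]
  · refine ⟨∅, n.zero_le, by simp, ?_⟩
    rw [Finset.coe_empty, Ideal.span_empty, sup_bot_eq, Ideal.radical_eq_sInf]
    refine le_sInf fun p ⟨hJp, hp⟩ => ?_
    by_contra hnot
    exact hdim (one_le_krullDim_zeroLocus hJ hJp hnot)

end Parameters

section Nakayama

variable {𝒜} {t : Set A} (ht : ∀ x ∈ t, ∃ d : ℕ, 0 < d ∧ x ∈ 𝒜 d)

include ht in
lemma decompose_mem_of_mem_span (S : Subalgebra (𝒜 0) A) (htS : t ⊆ S) (N : Submodule S A) {j : ℕ}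
    (hN : ∀ i < j, ∀ a ∈ 𝒜 i, a ∈ N) {e : A} (he : e ∈ Ideal.span t) :
    (decompose 𝒜 e j : A) ∈ N := by
  induction he using Submodule.closure_induction with
  | zero => simp
  | add x y _ _ hx hy => simpa using add_mem hx hy
  | smul_mem a x hx =>
    obtain ⟨d, hd, hxd⟩ := ht x hx
    rw [smul_eq_mul, mul_comm]
    by_cases hdj : d ≤ j
    · rw [coe_decompose_mul_of_left_mem_of_le 𝒜 hxd hdj]
      exact N.smul_mem (⟨x, htS hx⟩ : S) (hN _ (by omega) _ (SetLike.coe_mem _))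
    · rw [coe_decompose_mul_of_left_mem_of_not_le 𝒜 hxd hdj]
      exact zero_mem N

include ht in
lemma finite_of_finite_quotient_span (S : Subalgebra (𝒜 0) A) (htS : t ⊆ S)
    [Module.Finite (𝒜 0) (A ⧸ Ideal.span t)] : Module.Finite S A := by
  classical
  obtain ⟨n, g, hg⟩ := Module.Finite.exists_fin (R := 𝒜 0) (M := A ⧸ Ideal.span t)
  choose w hw using fun i => Ideal.Quotient.mk_surjective (g i)
  let W : Finset A :=
    Finset.univ.biUnion fun i =>
      (decompose 𝒜 (w i)).support.image fun j => (decompose 𝒜 (w i) j : A)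
  let N : Submodule S A := Submodule.span S W
  have hwN (i : Fin n) (j : ℕ) : (decompose 𝒜 (w i) j : A) ∈ N := by
    by_cases hzero : decompose 𝒜 (w i) j = 0
    · simp [hzero]
    · refine Submodule.subset_span (Finset.mem_biUnion.mpr ⟨i, Finset.mem_univ i, ?_⟩)
      exact Finset.mem_image_of_mem _ (DFinsupp.mem_support_iff.mpr hzero)
  have hhom (j : ℕ) : ∀ a ∈ 𝒜 j, a ∈ N := by
    induction j using Nat.strong_induction_on with
    | _ j ih =>
      intro a ha
      obtain ⟨c, hc⟩ := (Submodule.mem_span_range_iff_exists_fun (𝒜 0)).mp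
        (hg ▸ Submodule.mem_top : Ideal.Quotient.mk (Ideal.span t) a ∈ _)
      have he : a - ∑ i, c i * w i ∈ Ideal.span t := by
        rw [← Ideal.Quotient.eq, ← hc, map_sum]
        exact Finset.sum_congr rfl fun i _ => by rw [← hw]; rfl
      have hcomponent : a = (decompose 𝒜 (a - ∑ i, c i * w i) j : A) +
          ∑ i, c i * (decompose 𝒜 (w i) j : A) := by
        have hsum : (decompose 𝒜 (∑ i, c i * w i) j : A) =
            ∑ i, c i * (decompose 𝒜 (w i) j : A) := by
          simp_rw [← GradedRing.proj_apply, map_sum, GradedRing.proj_apply,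
            coe_decompose_mul_of_left_mem_zero 𝒜 (c _).2]
        rw [decompose_sub, DirectSum.sub_apply, AddSubgroupClass.coe_sub, hsum, sub_add_cancel,
          decompose_of_mem_same 𝒜 ha]
      rw [hcomponent]
      refine add_mem (decompose_mem_of_mem_span ht S htS N ih he) (sum_mem fun i _ => ?_)
      exact N.smul_mem (algebraMap (𝒜 0) S (c i)) (hwN i j)
  refine ⟨W, eq_top_iff.mpr fun a _ => ?_⟩
  rw [← sum_support_decompose 𝒜 a]
  exact sum_mem fun j _ => hhom j _ (SetLike.coe_mem _)

end Nakayama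

section Dimension

variable {𝒜}

variable (𝒜) in
lemma exists_finset_irrelevant_eq_span [IsNoetherianRing A] :
    ∃ t : Finset A, (∀ x ∈ t, ∃ d : ℕ, 0 < d ∧ x ∈ 𝒜 d) ∧
      (irrelevant 𝒜).toIdeal = Ideal.span t := by
  obtain ⟨t, ht, hspan⟩ := (Submodule.fg_span_iff_fg_span_finset_subset _).mp
    (irrelevant_eq_span 𝒜 ▸ IsNoetherian.noetherian (irrelevant 𝒜).toIdeal)
  exact ⟨t, fun x hx => by simpa using ht hx, (irrelevant_eq_span 𝒜).trans hspan⟩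

variable (𝒜) in
lemma finiteType_gradeZero [IsNoetherianRing A] : Algebra.FiniteType (𝒜 0) A := by
  obtain ⟨t, ht, hirr⟩ := exists_finset_irrelevant_eq_span 𝒜
  have hsurj : Function.Surjective (algebraMap (𝒜 0) (A ⧸ Ideal.span (t : Set A))) := by
    intro b
    obtain ⟨a, rfl⟩ := Ideal.Quotient.mk_surjective b
    refine ⟨decompose 𝒜 a 0, Ideal.Quotient.eq.mpr ?_⟩
    rw [← hirr]
    change _ ∈ irrelevant 𝒜
    rw [mem_irrelevant_iff, map_sub, sub_eq_zero, GradedRing.proj_apply]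
    exact decompose_of_mem_same 𝒜 (SetLike.coe_mem _)
  have : Module.Finite (𝒜 0) (A ⧸ Ideal.span (t : Set A)) :=
    Module.Finite.of_surjective (Algebra.linearMap _ _) hsurj
  have := finite_of_finite_quotient_span ht _ Algebra.subset_adjoin
  exact .trans (Subalgebra.fg_iff_finiteType _ |>.mp (Subalgebra.fg_adjoin_finset t)) inferInstance

lemma finite_quotient_of_irrelevant_le_radical [IsNoetherianRing A] {I : Ideal A}
    (hI : (irrelevant 𝒜).toIdeal ≤ I.radical) : Module.Finite (𝒜 0) (A ⧸ I) := by
  classical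
  have := finiteType_gradeZero 𝒜
  have hint : Algebra.IsIntegral (𝒜 0) (A ⧸ I) := ⟨fun b => by
    obtain ⟨a, rfl⟩ := Ideal.Quotient.mk_surjective b
    rw [← sum_support_decompose 𝒜 a, map_sum]
    refine IsIntegral.sum _ fun d _ => ?_
    rcases Nat.eq_zero_or_pos d with rfl | hd
    · exact isIntegral_algebraMap (x := decompose 𝒜 a 0)
    · obtain ⟨k, hk⟩ := hI (mem_irrelevant_of_mem 𝒜 hd (decompose 𝒜 a d).2)
      refine IsIntegral.of_pow k.succ_pos ?_
      rw [← map_pow, Ideal.Quotient.eq_zero_iff_mem.mpr (I.pow_mem_of_pow_mem hk k.le_succ)]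
      exact isIntegral_zero⟩
  exact Algebra.IsIntegral.finite

variable [IsNoetherianRing A] [Ring.KrullDimLE 0 (𝒜 0)]

lemma ringKrullDim_le_card_of_irrelevant_le_radical {t : Finset A}
    (ht : ∀ x ∈ t, ∃ d : ℕ, 0 < d ∧ x ∈ 𝒜 d)
    (hirr : (irrelevant 𝒜).toIdeal ≤ (Ideal.span (t : Set A)).radical) :
    ringKrullDim A ≤ t.card := by
  let S := Algebra.adjoin (𝒜 0) (t : Set A)
  have := finite_quotient_of_irrelevant_le_radical hirr
  have : Module.Finite S A := finite_of_finite_quotient_span ht S Algebra.subset_adjoin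
  let π : MvPolynomial t (𝒜 0) →ₐ[𝒜 0] A := MvPolynomial.aeval (↑)
  calc ringKrullDim A ≤ ringKrullDim S := ringKrullDim_le_of_isIntegral S A
    _ = ringKrullDim π.range := by
      rw [show S = π.range from Algebra.adjoin_eq_range (𝒜 0) (t : Set A)]
    _ ≤ ringKrullDim (MvPolynomial t (𝒜 0)) :=
      ringKrullDim_le_of_surjective π.rangeRestrict π.rangeRestrict_surjective
    _ = ringKrullDim (𝒜 0) + t.card := by
      rw [MvPolynomial.ringKrullDim_of_isNoetherianRing, Nat.card_eq_fintype_card,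
        Fintype.card_coe]
    _ ≤ 0 + t.card := by gcongr; exact Ring.krullDimLE_iff.mp inferInstance
    _ = t.card := zero_add _

include 𝒜 in
variable (𝒜) in
lemma ringKrullDim_ne_top_of_gradedRing : ringKrullDim A ≠ ⊤ := by
  obtain ⟨t, ht, hirr⟩ := exists_finset_irrelevant_eq_span 𝒜
  exact ((ringKrullDim_le_card_of_irrelevant_le_radical ht
    (hirr.le.trans Ideal.le_radical)).trans_lt (WithBot.coe_lt_coe.mpr (ENat.natCast_lt_top _))).ne

variable (𝒜) in
lemma exists_homogeneous_ringKrullDim_quotient_add_one_eq (hdim : 1 ≤ ringKrullDim A) :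
    ∃ d : ℕ, 0 < d ∧ ∃ r ∈ 𝒜 d, ringKrullDim (A ⧸ Ideal.span {r}) + 1 = ringKrullDim A := by
  classical
  have hbot : ringKrullDim A = Order.krullDim (zeroLocus ((⊥ : Ideal A) : Set A)) := by
    rw [← ringKrullDim_quotient, ringKrullDim_eq_of_ringEquiv (RingEquiv.quotientBot A)]
  obtain ⟨d, hd, r, hr, hle⟩ := exists_homogeneous_krullDim_zeroLocus_add_one_le
    (Ideal.IsHomogeneous.bot 𝒜) (hdim.trans_eq hbot)
  rw [← hbot, bot_sup_eq, ← ringKrullDim_quotient] at hle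
  refine ⟨d, hd, r, hr, hle.antisymm ?_⟩
  have : Nontrivial A := not_subsingleton_iff_nontrivial.mp fun _ =>
    absurd (ringKrullDim_eq_bot_of_subsingleton (R := A) ▸ hdim) (by simp)
  have : Nontrivial (A ⧸ Ideal.span {r}) := Ideal.Quotient.nontrivial_iff.mpr fun htop =>
    sup_irrelevant_ne_top (Ideal.IsHomogeneous.bot 𝒜) bot_ne_top <| top_le_iff.mp <|
      htop.ge.trans <| (Ideal.span_singleton_le_iff_mem _).mpr <|
        Ideal.mem_sup_right (mem_irrelevant_of_mem 𝒜 hd hr)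
  have : FiniteRingKrullDim (A ⧸ Ideal.span {r}) := finiteRingKrullDim_iff_ne_bot_and_top.mpr
    ⟨(ringKrullDim_nonneg_of_nontrivial.trans_lt' (WithBot.bot_lt_coe 0)).ne',
      ((ringKrullDim_quotient_le _).trans_lt (ringKrullDim_ne_top_of_gradedRing 𝒜).lt_top).ne⟩
  obtain ⟨n, hn⟩ : ∃ n : ℕ, ringKrullDim (A ⧸ Ideal.span {r}) = n :=
    ⟨_, Order.krullDim_eq_length_of_finiteDimensionalOrder⟩
  have hhom : (Ideal.span {r}).IsHomogeneous 𝒜 :=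
    Ideal.homogeneous_span 𝒜 _ (by rintro _ rfl; exact ⟨d, hr⟩)
  obtain ⟨t, htcard, ht, hirr⟩ := exists_finset_irrelevant_le_radical hhom
    ((ringKrullDim_quotient _).symm.trans hn).le
  rw [← Ideal.span_union, Set.singleton_union, ← Finset.coe_insert] at hirr
  calc ringKrullDim A ≤ (insert r t).card := ringKrullDim_le_card_of_irrelevant_le_radical
        (Finset.forall_mem_insert .. |>.mpr ⟨⟨d, hd, hr⟩, ht⟩) hirr
    _ ≤ (n + 1 : ℕ) := by exact_mod_cast (Finset.card_insert_le r t).trans (by omega)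
    _ = ringKrullDim (A ⧸ Ideal.span {r}) + 1 := by rw [hn]; norm_cast

end Dimension

end GradedRing

section Quotient

variable {ι A : Type*} [DecidableEq ι] [AddMonoid ι] [CommRing A]

/-- The grading which the quotient of a graded ring by an ideal `I` inherits; it is a `GradedRing`
as soon as `I` is homogeneous. -/
def quotientGrading (𝒜 : ι → AddSubgroup A) (I : Ideal A) (i : ι) : AddSubgroup (A ⧸ I) :=
  (𝒜 i).map (Ideal.Quotient.mk I).toAddMonoidHom

variable (𝒜 : ι → AddSubgroup A) [GradedRing 𝒜] (I : HomogeneousIdeal 𝒜)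

instance quotientGrading.gradedMonoid :
    SetLike.GradedMonoid (quotientGrading 𝒜 I.toIdeal) where
  one_mem := ⟨1, SetLike.GradedOne.one_mem, rfl⟩
  mul_mem := by
    rintro i j _ _ ⟨x, hx, rfl⟩ ⟨y, hy, rfl⟩
    exact ⟨x * y, SetLike.mul_mem_graded hx hy, rfl⟩

/-- The decomposition of `A ⧸ I` into homogeneous components, induced by that of `A`. -/
def quotientGrading.decomposeHom : A ⧸ I.toIdeal →+ ⨁ i, quotientGrading 𝒜 I.toIdeal i :=
  QuotientAddGroup.lift I.toIdeal.toAddSubgroup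
    ((DirectSum.map fun i =>
      (Ideal.Quotient.mk I.toIdeal).toAddMonoidHom.addSubgroupMap (𝒜 i)).comp
        (decomposeAddEquiv 𝒜).toAddMonoidHom)
    fun _ hx => DFinsupp.ext fun i => Subtype.ext <|
      Ideal.Quotient.eq_zero_iff_mem.mpr (I.isHomogeneous i hx)

lemma quotientGrading.decomposeHom_mk_of_mem {i : ι} {x : A} (hx : x ∈ 𝒜 i) :
    decomposeHom 𝒜 I (Ideal.Quotient.mk I.toIdeal x) =
      of (fun i => quotientGrading 𝒜 I.toIdeal i) i
        ⟨Ideal.Quotient.mk I.toIdeal x, x, hx, rfl⟩ := by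
  change DirectSum.map _ (decompose 𝒜 x) = _
  rw [decompose_of_mem 𝒜 hx, DirectSum.map_of]
  rfl

instance quotientGrading.gradedRing : GradedRing (quotientGrading 𝒜 I.toIdeal) where
  toDecomposition := Decomposition.ofAddHom _ (decomposeHom 𝒜 I)
    (by
      ext b
      obtain ⟨a, rfl⟩ := Ideal.Quotient.mk_surjective b
      induction a using Decomposition.inductionOn 𝒜 with
      | zero => simp only [map_zero]
      | add x y hx hy => simp only [map_add, hx, hy]
      | homogeneous x =>
        exact (congrArg _ (decomposeHom_mk_of_mem 𝒜 I x.2)).trans (coeAddMonoidHom_of _ _ _))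
    (by
      ext i ⟨_, x, hx, rfl⟩ : 2
      exact (congrArg _ (coeAddMonoidHom_of _ _ _)).trans (decomposeHom_mk_of_mem 𝒜 I hx))

end Quotient

section Module

open Module PrimeSpectrum

variable {A M : Type*} [CommRing A] [AddCommGroup M] [Module A M]
  {𝒜 : ℕ → AddSubgroup A} [GradedRing 𝒜] {I : HomogeneousIdeal 𝒜}
  (hI : I.toIdeal = annihilator A M) [Ring.KrullDimLE 0 (quotientGrading 𝒜 I.toIdeal 0)]

include hI

lemma isMaximal_of_annihilator_le_of_irrelevant_le {p : Ideal A} [hp : p.IsPrime]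
    (hann : annihilator A M ≤ p) (hirr : (HomogeneousIdeal.irrelevant 𝒜).toIdeal ≤ p) :
    p.IsMaximal := by
  let π := Ideal.Quotient.mk I.toIdeal
  have hker : RingHom.ker π ≤ p := by rwa [Ideal.mk_ker, hI]
  have := Ideal.map_isPrime_of_surjective Ideal.Quotient.mk_surjective hker
  have : (p.map π).IsMaximal := by
    refine isMaximal_of_irrelevant_le (quotientGrading 𝒜 I.toIdeal)
      ((HomogeneousIdeal.toIdeal_irrelevant_le _).mpr ?_)
    rintro d hd _ ⟨x, hx, rfl⟩
    exact Ideal.mem_map_of_mem π (hirr (HomogeneousIdeal.mem_irrelevant_of_mem 𝒜 hd hx))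
  rw [← sup_eq_left.mpr hker, ← Ideal.comap_map_of_surjective' π Ideal.Quotient.mk_surjective p]
  exact Ideal.comap_isMaximal_of_surjective π Ideal.Quotient.mk_surjective

variable [IsNoetherian A M]

lemma supportDim_ne_top_of_gradedRing : supportDim A M ≠ ⊤ := by
  have : IsNoetherianRing (A ⧸ I.toIdeal) := hI ▸ isNoetherianRing_quotient_annihilator A M
  rw [supportDim_eq_ringKrullDim_quotient_annihilator, ← hI]
  exact ringKrullDim_ne_top_of_gradedRing (quotientGrading 𝒜 I.toIdeal)

lemma exists_homogeneous_supportDim_quotSMulTop_add_one_eq (hdim : 1 ≤ supportDim A M) :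
    ∃ d : ℕ, 0 < d ∧ ∃ r ∈ 𝒜 d, supportDim A (QuotSMulTop r M) + 1 = supportDim A M := by
  have : IsNoetherianRing (A ⧸ I.toIdeal) := hI ▸ isNoetherianRing_quotient_annihilator A M
  have hM : supportDim A M = ringKrullDim (A ⧸ I.toIdeal) := by
    rw [supportDim_eq_ringKrullDim_quotient_annihilator, ← hI]
  obtain ⟨d, hd, _, ⟨r, hr, rfl⟩, hdrop⟩ :=
    exists_homogeneous_ringKrullDim_quotient_add_one_eq (quotientGrading 𝒜 I.toIdeal) (hM ▸ hdim)
  refine ⟨d, hd, r, hr, ?_⟩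
  have hquot : supportDim A (QuotSMulTop r M) = ringKrullDim (A ⧸ I.toIdeal ⊔ Ideal.span {r}) := by
    rw [supportDim, support_quotSMulTop, support_eq_zeroLocus, ← hI, ringKrullDim_quotient,
      zeroLocus_sup, zeroLocus_span]
  rw [hM, ← hdrop, hquot,
    ← (DoubleQuot.quotQuotEquivQuotSup I.toIdeal (Ideal.span {r})).ringKrullDim,
    Ideal.map_span, Set.image_singleton]
  rfl

end Module

/-! ### The even subring of a graded-commutative ring -/

section EvenGrading

variable {R : Type w} [Ring R] (𝒜 : ℕ → AddSubgroup R) [GradedRing 𝒜]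

lemma mem_evenSubring_of_mem {i : ℕ} (hi : Even i) {r : R} (hr : r ∈ 𝒜 i) : r ∈ evenSubring 𝒜 := by
  intro j hj
  refine decompose_of_mem_ne 𝒜 hr ?_
  rintro rfl
  exact Nat.not_odd_iff_even.mpr hi hj

lemma decompose_mem_evenSubring {a : R} (ha : a ∈ evenSubring 𝒜) (i : ℕ) :
    (decompose 𝒜 a i : R) ∈ evenSubring 𝒜 := by
  rcases Nat.even_or_odd i with hi | hi
  · exact mem_evenSubring_of_mem 𝒜 hi (SetLike.coe_mem _)
  · rw [ha i hi]
    exact zero_mem _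

/-- The grading of `R^ev` induced by that of `R`. Degrees are not halved, so the components of odd
degree vanish. -/
def evenGrading (i : ℕ) : AddSubgroup (evenSubring 𝒜) :=
  (𝒜 i).comap (evenSubring 𝒜).subtype.toAddMonoidHom

lemma isInternal_evenGrading : IsInternal (evenGrading 𝒜) := by
  classical
  let incl := (evenSubring 𝒜).subtype.toAddMonoidHom
  constructor
  · let F : (⨁ i, evenGrading 𝒜 i) →+ ⨁ i, 𝒜 i :=
      DirectSum.map fun i => (incl.comp (evenGrading 𝒜 i).subtype).codRestrict (𝒜 i) fun x => x.2
    have hF : Function.Injective F := (DirectSum.map_injective _).mpr fun i x y h =>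
      Subtype.ext (Subtype.ext (congrArg (fun z : 𝒜 i => (z : R)) h))
    have hcomp : incl.comp (DirectSum.coeAddMonoidHom (evenGrading 𝒜)) =
        (DirectSum.coeAddMonoidHom 𝒜).comp F := by
      ext i x
      simp [F, incl, DirectSum.map_of]
    refine .of_comp (f := incl) ?_
    rw [← AddMonoidHom.coe_comp, hcomp]
    exact (Decomposition.isInternal 𝒜).1.comp hF
  · intro a
    refine ⟨∑ i ∈ DFinsupp.support (decompose 𝒜 (a : R)), DirectSum.of (fun i => evenGrading 𝒜 i) i
      ⟨⟨decompose 𝒜 (a : R) i, decompose_mem_evenSubring 𝒜 a.2 i⟩,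
        SetLike.coe_mem (decompose 𝒜 (a : R) i)⟩, ?_⟩
    simp only [map_sum, DirectSum.coeAddMonoidHom_of]
    apply Subtype.ext
    rw [AddSubmonoidClass.coe_finsetSum]
    exact sum_support_decompose 𝒜 (a : R)

instance evenGrading.decomposition : Decomposition (evenGrading 𝒜) :=
  (isInternal_evenGrading 𝒜).chooseDecomposition

instance evenGrading.gradedRing [IsGradedCommutative 𝒜] : GradedRing (evenGrading 𝒜) where
  one_mem := SetLike.GradedOne.one_mem (A := 𝒜)
  mul_mem _ _ _ _ ha hb := SetLike.GradedMul.mul_mem (A := 𝒜) ha hb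

lemma exists_evenSubring_add_sum_odd (r : R) : ∃ (a : evenSubring 𝒜) (s : Finset ℕ),
    (∀ i ∈ s, Odd i) ∧ r = a + ∑ i ∈ s, (decompose 𝒜 r i : R) := by
  classical
  refine ⟨⟨∑ i ∈ (decompose 𝒜 r).support with Even i, (decompose 𝒜 r i : R),
    sum_mem fun i hi => mem_evenSubring_of_mem 𝒜 (Finset.mem_filter.mp hi).2 (SetLike.coe_mem _)⟩,
    {i ∈ (decompose 𝒜 r).support | ¬ Even i}, fun i hi => ?_, ?_⟩
  · exact Nat.not_even_iff_odd.mp (Finset.mem_filter.mp hi).2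
  · rw [Finset.sum_filter_add_sum_filter_not, sum_support_decompose]

variable [IsGradedCommutative 𝒜] (I : HomogeneousIdeal (evenGrading 𝒜))

/-- The projection of `R₀` onto the degree zero part of `R^ev ⧸ I`. -/
def gradeZeroToEvenQuotient :
    SetLike.GradeZero.subring 𝒜 →+* quotientGrading (evenGrading 𝒜) I.toIdeal 0 where
  toFun s := ⟨Ideal.Quotient.mk _ ⟨s, mem_evenSubring_of_mem 𝒜 Even.zero s.2⟩, _, s.2, rfl⟩
  map_one' := rfl
  map_mul' _ _ := rfl
  map_zero' := rfl
  map_add' _ _ := rfl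

lemma gradeZeroToEvenQuotient_surjective :
    Function.Surjective (gradeZeroToEvenQuotient 𝒜 I) := by
  rintro ⟨_, a, ha, rfl⟩
  exact ⟨⟨a, ha⟩, rfl⟩

end EvenGrading

/-! ### Graded modules of morphisms over the even subring -/

namespace CentralAction

section GradedModule

variable {C : Type u} [Category.{v} C] [Preadditive C] [HasShift C ℤ]
  [∀ n : ℤ, (shiftFunctor C n).Additive]
  {R : Type w} [Ring R] {𝒜 : ℕ → AddSubgroup R} [GradedRing 𝒜] (α : CentralAction C 𝒜) {X Y : C}

/-- The projection of `Hom^*(X,Y)` to its component of degree `j`. -/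
def componentHom (X Y : C) (j : ℤ) : α.HomStar X Y →+ ShiftedHom X Y j where
  toFun f := α.component f j
  map_zero' := rfl
  map_add' _ _ := rfl

lemma of_eq_zero_iff {i : ℤ} {g : ShiftedHom X Y i} : α.of X Y i g = 0 ↔ g = 0 :=
  map_eq_zero_iff _ (DirectSum.of_injective i)

lemma homStar_ext {f g : α.HomStar X Y} (h : ∀ i, α.component f i = α.component g i) : f = g :=
  DFinsupp.ext h

open Classical in
/-- The finite set of degrees in which an element of `Hom^*(X,Y)` is nonzero. -/
def degrees (f : α.HomStar X Y) : Finset ℤ :=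
  DFinsupp.support (show ⨁ i : ℤ, ShiftedHom X Y i from f)

lemma sum_of_component (f : α.HomStar X Y) :
    ∑ i ∈ α.degrees f, α.of X Y i (α.component f i) = f := by
  classical
  exact DirectSum.sum_support_of (show ⨁ i : ℤ, ShiftedHom X Y i from f)

lemma le_of_mem_degrees {n : ℤ} {f : α.HomStar X Y} (hf : f ∈ α.homGE X Y n) {i : ℤ}
    (hi : i ∈ α.degrees f) : n ≤ i := by
  classical
  by_contra! h
  exact DFinsupp.mem_support_iff.mp hi (hf i h)

lemma of_mem_homGE {n i : ℤ} (hi : n ≤ i) (g : ShiftedHom X Y i) :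
    α.of X Y i g ∈ α.homGE X Y n :=
  fun _ hj => α.component_of_ne g (by omega)

lemma homGE_anti (X Y : C) : Antitone (α.homGE X Y) :=
  fun _ _ h _ hf i hi => hf i (by omega)

lemma homGE_induction {n : ℤ} {motive : α.HomStar X Y → Prop}
    (of : ∀ i, n ≤ i → ∀ g : ShiftedHom X Y i, motive (α.of X Y i g))
    (add : ∀ f g, motive f → motive g → motive (f + g)) {f : α.HomStar X Y}
    (hf : f ∈ α.homGE X Y n) : motive f := by
  rw [← α.sum_of_component f]
  exact Finset.sum_induction _ motive add (map_zero (α.of X Y n) ▸ of n le_rfl 0)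
    fun i hi => of i (α.le_of_mem_degrees hf hi) _

section Annihilator

variable [IsGradedCommutative 𝒜]

lemma isHomogeneous_torsionOf_of {i : ℤ} (g : ShiftedHom X Y i) :
    (Ideal.torsionOf (evenSubring 𝒜) (α.HomStar X Y) (α.of X Y i g)).IsHomogeneous
      (evenGrading 𝒜) := by
  classical
  intro j a ha
  rw [Ideal.mem_torsionOf_iff] at ha ⊢
  let part (k : ℕ) := (decompose (evenGrading 𝒜) a k : evenSubring 𝒜) • α.of X Y i g
  have hpart (k : ℕ) (l : ℤ) (hl : (k : ℤ) + i ≠ l) : α.component (part k) l = 0 :=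
    α.component_smul_eq_zero ⟨_, (decompose (evenGrading 𝒜) a k).2⟩ _ l
      fun m hm => α.component_of_ne g (by omega)
  refine α.homStar_ext fun l => ?_
  by_cases hl : (j : ℤ) + i = l
  · calc α.component (part j) l
        = α.componentHom X Y l (∑ k ∈ (decompose (evenGrading 𝒜) a).support, part k) := by
          rw [map_sum]
          refine (Finset.sum_eq_single (M := ShiftedHom X Y l) j
            (fun k _ hk => hpart k l (by omega)) fun hj => ?_).symm
          simp [part, DFinsupp.notMem_support_iff.mp hj, component_zero]
      _ = 0 := by rw [← Finset.sum_smul, sum_support_decompose, ha, map_zero]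
  · exact hpart j l hl

lemma mem_annihilator_homGE {n : ℤ} {a : evenSubring 𝒜} :
    a ∈ Module.annihilator (evenSubring 𝒜) (α.homGE X Y n) ↔
      ∀ i, n ≤ i → ∀ g : ShiftedHom X Y i, a • α.of X Y i g = 0 := by
  rw [Module.mem_annihilator]
  refine ⟨fun h i hi g => congrArg Subtype.val (h ⟨_, α.of_mem_homGE hi g⟩), fun h f => ?_⟩
  refine Subtype.ext (α.homGE_induction (motive := fun f => a • f = 0) h (fun f g hf hg => ?_) f.2)
  rw [smul_add, hf, hg, add_zero]

/-- The annihilator of `Hom^{≥ n}(X,Y)` over `R^ev`, as a homogeneous ideal. -/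
def homGEAnnihilator (X Y : C) (n : ℤ) : HomogeneousIdeal (evenGrading 𝒜) where
  __ := Module.annihilator (evenSubring 𝒜) (α.homGE X Y n)
  is_homogeneous' := by
    intro j a ha
    change a ∈ Module.annihilator _ _ at ha
    change _ ∈ Module.annihilator _ _
    rw [mem_annihilator_homGE] at ha ⊢
    exact fun i hi g => α.isHomogeneous_torsionOf_of g j (ha i hi g)

lemma exists_homogeneous_generators_homGE (X Y : C) (n : ℤ)
    [Module.Finite (evenSubring 𝒜) (α.homGE X Y n)] :
    ∃ (ι : Type v) (_ : Finite ι) (δ : ι → ℤ) (g : ∀ k, ShiftedHom X Y (δ k)),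
      (∀ k, n ≤ δ k) ∧ ∀ a : evenSubring 𝒜, (∀ k, a • α.of X Y (δ k) (g k) = 0) →
        a ∈ Module.annihilator (evenSubring 𝒜) (α.homGE X Y n) := by
  obtain ⟨S, hS⟩ := Module.Finite.fg_top (R := evenSubring 𝒜) (M := α.homGE X Y n)
  refine ⟨Σ s : S, α.degrees s.1.1, inferInstance, fun k => k.2,
    fun k => α.component k.1.1.1 k.2, fun k => α.le_of_mem_degrees k.1.1.2 k.2.2, fun a ha => ?_⟩
  rw [← Submodule.annihilator_top, ← hS, Submodule.mem_annihilator_span]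
  intro s
  apply Subtype.ext
  change a • s.1.1 = 0
  rw [← α.sum_of_component s.1.1, Finset.smul_sum]
  exact Finset.sum_eq_zero fun i hi => ha ⟨s, i, hi⟩

lemma krullDimLE_zero_quotientGrading_homGEAnnihilator {n : ℤ}
    [Module.Finite (evenSubring 𝒜) (α.homGE X Y n)]
    (hlen : ∀ i, n ≤ i → IsFiniteLength (SetLike.GradeZero.subring 𝒜) (α.homDegree X Y i)) :
    Ring.KrullDimLE 0
      (quotientGrading (evenGrading 𝒜) (α.homGEAnnihilator X Y n).toIdeal 0) := by
  obtain ⟨ι, _, δ, g, hδ, hann⟩ := α.exists_homogeneous_generators_homGE X Y n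
  have (k : ι) : IsArtinian (SetLike.GradeZero.subring 𝒜) (α.homDegree X Y (δ k)) :=
    (isFiniteLength_iff_isNoetherian_isArtinian.mp (hlen _ (hδ k))).2
  let m : ∀ k, α.homDegree X Y (δ k) := fun k =>
    ⟨α.of X Y (δ k) (g k), fun _ hj => α.component_of_ne _ hj.symm⟩
  have hm (s : SetLike.GradeZero.subring 𝒜) (hs : s • m = 0) :
      gradeZeroToEvenQuotient 𝒜 (α.homGEAnnihilator X Y n) s = 0 :=
    Subtype.ext <| Ideal.Quotient.eq_zero_iff_mem.mpr <|
      hann _ fun k => congrArg Subtype.val (congrFun hs k)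
  have := isArtinianRing_of_surjective_of_smul_eq_zero _
    (gradeZeroToEvenQuotient_surjective 𝒜 _) m hm
  infer_instance

end Annihilator

/-- The elements of `Hom^*(X,Y)` concentrated in degrees congruent to `ε` modulo `2`. -/
def parityPart (X Y : C) (ε : ℤ) : Submodule (evenSubring 𝒜) (α.HomStar X Y) where
  carrier := {f | ∀ i : ℤ, ¬ Even (i + ε) → α.component f i = 0}
  zero_mem' := fun _ _ => rfl
  add_mem' := by
    intro f g hf hg i hi
    rw [component_add, hf i hi, hg i hi, add_zero]
  smul_mem' := by
    classical
    intro a f hf j hj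
    change α.componentHom X Y j ((a : R) • f) = 0
    rw [← sum_support_decompose 𝒜 (a : R), Finset.sum_smul, map_sum]
    refine Finset.sum_eq_zero fun d _ => ?_
    rcases Nat.even_or_odd d with hd | hd
    · refine α.component_smul_eq_zero _ f j fun i hi => hf i fun hi' => hj ?_
      rw [← hi, add_assoc]
      exact ((Int.even_coe_nat d).mpr hd).add hi'
    · rw [a.2 d hd, zero_smul, map_zero]

lemma of_mem_parityPart {i ε : ℤ} (hi : Even (i + ε)) (g : ShiftedHom X Y i) :
    α.of X Y i g ∈ α.parityPart X Y ε :=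
  fun _ hj => α.component_of_ne g (by rintro rfl; exact hj hi)

lemma smul_mem_parityPart_of_odd {ε : ℤ} {d : ℕ} (hd : Odd d) (r : 𝒜 d)
    {f : α.HomStar X Y} (hf : f ∈ α.parityPart X Y ε) :
    (r : R) • f ∈ α.parityPart X Y (ε + 1) := by
  intro j hj
  refine α.component_smul_eq_zero r f j fun i hi => hf i fun hi' => hj ?_
  have hd' : Odd (d : ℤ) := (Int.odd_coe_nat d).mpr hd
  rw [show j + (ε + 1) = (i + ε) + ((d : ℤ) + 1) by omega]
  exact hi'.add hd'.add_one

lemma disjoint_parityPart (X Y : C) (ε : ℤ) :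
    Disjoint (α.parityPart X Y ε) (α.parityPart X Y (ε + 1)) := by
  rw [Submodule.disjoint_def]
  refine fun f h h' => α.homStar_ext fun i => ?_
  by_cases hi : Even (i + ε)
  · exact h' i (by rw [← add_assoc, Int.not_even_iff_odd]; exact hi.add_one)
  · exact h i hi

lemma mem_of_mem_span_of_mem_parityPart {ε : ℤ} {N : Submodule (evenSubring 𝒜) (α.HomStar X Y)}
    (hN : N ≤ α.parityPart X Y ε) {t : Finset (α.HomStar X Y)} (ht : ∀ y ∈ t, y ∈ N)
    {x : α.HomStar X Y} (hx : x ∈ Submodule.span R (t : Set (α.HomStar X Y)))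
    (hxε : x ∈ α.parityPart X Y ε) : x ∈ N := by
  obtain ⟨c, -, rfl⟩ := Submodule.mem_span_finset.mp hx
  choose a s hs hc using fun y => exists_evenSubring_add_sum_odd 𝒜 (c y)
  let even : α.HomStar X Y := ∑ y ∈ t, a y • y
  let odd : α.HomStar X Y := ∑ y ∈ t, ∑ i ∈ s y, (decompose 𝒜 (c y) i : R) • y
  have hsplit : ∑ y ∈ t, c y • y = even + odd := by
    rw [← Finset.sum_add_distrib]
    refine Finset.sum_congr rfl fun y _ => ?_
    conv_lhs => rw [hc y, add_smul, Finset.sum_smul]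
    rfl
  have heven : even ∈ N := sum_mem fun y hy => N.smul_mem _ (ht y hy)
  have hodd : odd ∈ α.parityPart X Y (ε + 1) := sum_mem fun y hy => sum_mem fun i hi =>
    α.smul_mem_parityPart_of_odd (hs y i hi) _ (hN (ht y hy))
  have hodd' : odd ∈ α.parityPart X Y ε := by
    rw [hsplit] at hxε
    exact (Submodule.add_mem_iff_right _ (hN heven)).mp hxε
  rw [hsplit, Submodule.disjoint_def.mp (α.disjoint_parityPart X Y ε) _ hodd' hodd, add_zero]
  exact heven

lemma isNoetherian_inf_parityPart {N : Submodule R (α.HomStar X Y)} [IsNoetherian R N] (ε : ℤ) :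
    IsNoetherian (evenSubring 𝒜)
      (N.restrictScalars (evenSubring 𝒜) ⊓ α.parityPart X Y ε :
        Submodule (evenSubring 𝒜) (α.HomStar X Y)) := by
  rw [isNoetherian_submodule]
  intro s hs
  have hfg : (Submodule.span R (s : Set (α.HomStar X Y))).FG :=
    isNoetherian_submodule.mp ‹_› _ (Submodule.span_le.mpr fun x hx => (hs hx).1)
  obtain ⟨t, hts, ht⟩ := (Submodule.fg_span_iff_fg_span_finset_subset _).mp hfg
  have hle : Submodule.span (evenSubring 𝒜) (t : Set (α.HomStar X Y)) ≤ s :=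
    Submodule.span_le.mpr hts
  refine ⟨t, le_antisymm hle fun x hx => ?_⟩
  exact α.mem_of_mem_span_of_mem_parityPart (fun y hy => (hs (hle hy)).2)
    (fun y hy => Submodule.subset_span hy) (ht ▸ Submodule.subset_span hx) (hs hx).2

lemma isNoetherian_evenSubring_homGE (X Y : C) (n : ℤ) [IsNoetherian R (α.homGE X Y n)] :
    IsNoetherian (evenSubring 𝒜) (α.homGE X Y n) := by
  let G := (α.homGE X Y n).restrictScalars (evenSubring 𝒜)
  have hG : G = (G ⊓ α.parityPart X Y 0) ⊔ (G ⊓ α.parityPart X Y 1) := by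
    refine le_antisymm (fun f hf => ?_) (sup_le inf_le_left inf_le_left)
    refine α.homGE_induction (motive := (· ∈ G ⊓ α.parityPart X Y 0 ⊔ G ⊓ α.parityPart X Y 1))
      (fun i hi g => ?_) (fun _ _ => add_mem) hf
    rcases Int.even_or_odd i with h | h
    · exact Submodule.mem_sup_left
        ⟨α.of_mem_homGE hi g, α.of_mem_parityPart ((add_zero i).symm ▸ h) g⟩
    · exact Submodule.mem_sup_right ⟨α.of_mem_homGE hi g, α.of_mem_parityPart h.add_one g⟩
  have := α.isNoetherian_inf_parityPart (N := α.homGE X Y n) 0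
  have := α.isNoetherian_inf_parityPart (N := α.homGE X Y n) 1
  change IsNoetherian (evenSubring 𝒜) G
  rw [hG]
  infer_instance

end GradedModule

end CentralAction

/-! ### Central elements and shifts -/

section CenterShift

variable {C : Type u} [Category.{v} C] [Preadditive C] [HasShift C ℤ]
  [∀ n : ℤ, (shiftFunctor C n).Additive]

lemma gradedCenter.app_shift_add_one_iff {n : ℤ} (f : gradedCenter C n) (Z : C) (i : ℤ) :
    f.1.app (Z⟦i + 1⟧) = (n * (i + 1)).negOnePow •
        ((f.1.app Z)⟦i + 1⟧' ≫ (shiftFunctorComm C n (i + 1)).hom.app Z) ↔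
      f.1.app (Z⟦i⟧) = (n * i).negOnePow •
        ((f.1.app Z)⟦i⟧' ≫ (shiftFunctorComm C n i).hom.app Z) := by
  have hnat := f.1.naturality ((shiftFunctorAdd C i 1).hom.app Z)
  have hcenter := f.2 (Z⟦i⟧)
  have hcomm := shiftFunctorComm_hom_app_comp_shift_shiftFunctorAdd_hom_app (C := C) n i 1 Z
  have hadd := (shiftFunctorAdd C i 1).hom.naturality (f.1.app Z)
  dsimp at hnat hadd
  simp only [shiftComm, Iso.app_hom] at hcenter
  rw [← cancel_mono (((shiftFunctorAdd C i 1).hom.app Z)⟦n⟧'), ← hnat, hcenter, mul_add, mul_one,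
    Int.negOnePow_add]
  simp only [Linear.units_smul_comp, Linear.comp_units_smul, Category.assoc, hcomm]
  rw [reassoc_of% hadd, mul_comm (n * i).negOnePow, mul_smul, smul_left_cancel_iff,
    ← Linear.comp_units_smul, cancel_epi, ← Functor.map_comp_assoc, ← Linear.units_smul_comp,
    cancel_mono, ← Functor.map_units_smul]
  exact (shiftFunctor C (1 : ℤ)).map_injective.eq_iff

lemma gradedCenter.app_shift {n : ℤ} (f : gradedCenter C n) (Z : C) (i : ℤ) :
    f.1.app (Z⟦i⟧) = (n * i).negOnePow •
        ((f.1.app Z)⟦i⟧' ≫ (shiftFunctorComm C n i).hom.app Z) := by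
  induction i using Int.induction_on with
  | zero =>
    have hnat := f.1.naturality ((shiftFunctorZero C ℤ).hom.app Z)
    have hzero := (shiftFunctorZero C ℤ).hom.naturality (f.1.app Z)
    dsimp at hnat hzero
    rw [shiftFunctorComm_zero_hom_app, reassoc_of% hzero, mul_zero, Int.negOnePow_zero, one_smul,
      reassoc_of% hnat, ← Functor.map_comp]
    simp
  | succ i ih => exact (gradedCenter.app_shift_add_one_iff f Z i).mpr ih
  | pred i ih =>
    refine (gradedCenter.app_shift_add_one_iff f Z (-i - 1)).mp ?_
    rwa [sub_add_cancel]

/-- The interchange of shifts with the sign `(-1)^{ni}` that occurs in the formula for a central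
element of degree `n` at the `i`-th shift of an object. -/
def signedShiftComm (Z : C) (n i : ℤ) : Z⟦n⟧⟦i⟧ ≅ Z⟦i⟧⟦n⟧ where
  hom := (n * i).negOnePow • (shiftFunctorComm C n i).hom.app Z
  inv := (n * i).negOnePow • (shiftFunctorComm C n i).inv.app Z
  hom_inv_id := by
    simp [Linear.units_smul_comp, Linear.comp_units_smul, smul_smul, Int.units_mul_self]
  inv_hom_id := by
    simp [Linear.units_smul_comp, Linear.comp_units_smul, smul_smul, Int.units_mul_self]

/-- The canonical isomorphism `Σʲ Σⁱ Z ≅ Σᵏ Z` for `i + j = k`. -/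
def shiftShiftIso (Z : C) {i j k : ℤ} (h : i + j = k) : Z⟦i⟧⟦j⟧ ≅ Z⟦k⟧ :=
  ((shiftFunctorAdd' C i j k h).app Z).symm

/-- The isomorphism `Σⁿ Σⁱ Z ≅ Σᵏ Z` for `n + i = k` that first interchanges the shifts, with a
sign, as required to express products with central elements of degree `n`. -/
def signedShiftAdd (Z : C) {n i k : ℤ} (h : n + i = k) : Z⟦i⟧⟦n⟧ ≅ Z⟦k⟧ :=
  (signedShiftComm Z n i).symm ≪≫ shiftShiftIso Z h

end CenterShift

namespace CentralAction

section Preadditive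

variable {C : Type u} [Category.{v} C] [Preadditive C] [HasShift C ℤ]
  [∀ n : ℤ, (shiftFunctor C n).Additive]
  {R : Type w} [Ring R] {𝒜 : ℕ → AddSubgroup R} [GradedRing 𝒜] (α : CentralAction C 𝒜)

lemma phi_naturality {Y Z : C} (g : Y ⟶ Z) {d : ℕ} (r : 𝒜 d) :
    g ≫ α.phi Z r = α.phi Y r ≫ g⟦(d : ℤ)⟧' :=
  (α.toCenter d r).1.naturality g

lemma phi_naturality_assoc {Y Z W : C} (g : Y ⟶ Z) {d : ℕ} (r : 𝒜 d) (h : Z⟦(d : ℤ)⟧ ⟶ W) :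
    g ≫ α.phi Z r ≫ h = α.phi Y r ≫ g⟦(d : ℤ)⟧' ≫ h := by
  rw [← Category.assoc, phi_naturality, Category.assoc]

lemma phi_shift (Z : C) (i : ℤ) {d : ℕ} (r : 𝒜 d) :
    α.phi (Z⟦i⟧) r = (α.phi Z r)⟦i⟧' ≫ (signedShiftComm Z (d : ℤ) i).hom := by
  simp only [signedShiftComm, Linear.comp_units_smul]
  exact gradedCenter.app_shift (α.toCenter d r) Z i

lemma shift_phi (Z : C) (i : ℤ) {d : ℕ} (r : 𝒜 d) :
    (α.phi Z r)⟦i⟧' = α.phi (Z⟦i⟧) r ≫ (signedShiftComm Z (d : ℤ) i).inv := by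
  rw [phi_shift, Category.assoc, Iso.hom_inv_id, Category.comp_id]

lemma phi_shift_self (Z : C) {d : ℕ} (r : 𝒜 d) :
    α.phi (Z⟦(d : ℤ)⟧) r = ((d : ℤ) * d).negOnePow • (α.phi Z r)⟦(d : ℤ)⟧' := by
  rw [phi_shift]
  simp [signedShiftComm, Linear.comp_units_smul]

/-- The product of two homogeneous elements, with its degree. -/
def hmul {m n : ℕ} (r : 𝒜 m) (s : 𝒜 n) : 𝒜 (m + n) :=
  ⟨r.1 * s.1, SetLike.GradedMul.mul_mem r.2 s.2⟩

lemma phi_hmul (Z : C) {m n : ℕ} (r : 𝒜 m) (s : 𝒜 n) :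
    α.phi Z (hmul r s) = α.phi Z s ≫ α.phi (Z⟦(n : ℤ)⟧) r ≫
      (signedShiftAdd Z (Nat.cast_add m n).symm).hom := by
  simp only [phi_shift, signedShiftAdd, Iso.trans_hom, Iso.symm_hom, Category.assoc,
    Iso.hom_inv_id_assoc]
  exact congrArg (fun z : gradedCenter C ((m + n : ℕ) : ℤ) => z.1.app Z) (α.map_mul m n r s)

lemma smul_of_eq {X Y : C} {d : ℕ} {i : ℤ} (r : 𝒜 d) (g : X ⟶ Y⟦i⟧) :
    (r : R) • α.of X Y i g =
      α.of X Y ((d : ℤ) + i) (g ≫ α.phi (Y⟦i⟧) r ≫ (signedShiftAdd Y rfl).hom) := by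
  rw [smul_of, phi_shift]
  simp only [signedShiftAdd, Iso.trans_hom, Iso.symm_hom, Category.assoc, Iso.hom_inv_id_assoc]
  rfl

lemma smul_of_eq_zero_iff {X Y : C} {d : ℕ} {i : ℤ} (r : 𝒜 d) (g : X ⟶ Y⟦i⟧) :
    (r : R) • α.of X Y i g = 0 ↔ g ≫ α.phi (Y⟦i⟧) r = 0 := by
  rw [smul_of_eq, of_eq_zero_iff, ← Category.assoc, Preadditive.IsIso.comp_right_eq_zero]

lemma phi_hmul_eq_zero_iff {Z : C} {m n : ℕ} (r : 𝒜 m) (s : 𝒜 n) :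
    α.phi Z (hmul r s) = 0 ↔ (r : R) • α.of Z Z n (α.phi Z s) = 0 := by
  rw [smul_of_eq_zero_iff, phi_hmul, ← Category.assoc, Preadditive.IsIso.comp_right_eq_zero]

lemma exists_of_eq_smul_of {X Y W : C} {d : ℕ} (r : 𝒜 d) (u : X ⟶ W) {k : ℤ}
    (ι : W⟦(d : ℤ)⟧ ⟶ Y⟦(d : ℤ) + k⟧) :
    ∃ w : X ⟶ Y⟦k⟧, α.of X Y (d + k) (u ≫ α.phi W r ≫ ι) = (r : R) • α.of X Y k w := by
  obtain ⟨ρ, hρ⟩ := (shiftFunctor C (d : ℤ)).map_surjective (ι ≫ (signedShiftAdd Y rfl).inv)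
  refine ⟨u ≫ ρ, ?_⟩
  rw [smul_of_eq, Category.assoc, α.phi_naturality_assoc ρ, hρ, Category.assoc, Iso.inv_hom_id,
    Category.comp_id]

/-- The homogeneous element `a` annihilates all morphisms from `Y` to `Z`. -/
def Kills {e : ℕ} (a : 𝒜 e) (Y Z : C) : Prop := ∀ g : Y ⟶ Z, g ≫ α.phi Z a = 0

/-- The morphism `φ_W(b)` factors through some `φ_V(r)`. Multiplication by `b` on morphisms to `W`
then takes values in the multiples of `r`. -/
def PhiFactors {d e : ℕ} (r : 𝒜 d) (b : 𝒜 e) (W : C) : Prop :=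
  ∃ (V : C) (u : W ⟶ V) (ι : V⟦(d : ℤ)⟧ ⟶ W⟦(e : ℤ)⟧), α.phi W b = u ≫ α.phi V r ≫ ι

variable {α}

lemma Kills.of_iso {e : ℕ} {a : 𝒜 e} {Y Z Z' : C} (h : α.Kills a Y Z) (i : Z ≅ Z') :
    α.Kills a Y Z' := by
  intro g
  rw [← cancel_mono (i.inv⟦(e : ℤ)⟧'), Category.assoc, ← α.phi_naturality, ← Category.assoc, h,
    zero_comp]

lemma Kills.shift {e : ℕ} {a : 𝒜 e} {Y Z : C} (h : α.Kills a Y Z) (i : ℤ) :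
    α.Kills a (Y⟦i⟧) (Z⟦i⟧) := by
  intro g
  obtain ⟨g, rfl⟩ := (shiftFunctor C i).map_surjective g
  rw [phi_shift, ← Functor.map_comp_assoc, h g, Functor.map_zero, zero_comp]

lemma kills_hmul_iff {m n : ℕ} {r : 𝒜 m} {s : 𝒜 n} {Y Z : C} :
    α.Kills (hmul r s) Y Z ↔ ∀ g : Y ⟶ Z, g ≫ α.phi Z s ≫ α.phi (Z⟦(n : ℤ)⟧) r = 0 := by
  refine forall_congr' fun g => ?_
  rw [phi_hmul, ← Category.assoc, ← Category.assoc, Preadditive.IsIso.comp_right_eq_zero,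
    Category.assoc]

lemma PhiFactors.of_iso {d e : ℕ} {r : 𝒜 d} {b : 𝒜 e} {W W' : C} (h : α.PhiFactors r b W)
    (i : W ≅ W') : α.PhiFactors r b W' := by
  obtain ⟨V, u, ι, h⟩ := h
  refine ⟨V, i.inv ≫ u, ι ≫ i.hom⟦(e : ℤ)⟧', ?_⟩
  rw [← cancel_epi i.hom, α.phi_naturality, h]
  simp only [Category.assoc, Iso.hom_inv_id_assoc]

lemma PhiFactors.shift {d e : ℕ} {r : 𝒜 d} {b : 𝒜 e} {W : C} (h : α.PhiFactors r b W) (i : ℤ) :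
    α.PhiFactors r b (W⟦i⟧) := by
  obtain ⟨V, u, ι, h⟩ := h
  refine ⟨V⟦i⟧, u⟦i⟧', (signedShiftComm V d i).inv ≫ ι⟦i⟧' ≫ (signedShiftComm W e i).hom, ?_⟩
  rw [phi_shift, h, Functor.map_comp, Functor.map_comp, shift_phi]
  simp only [Category.assoc]

lemma PhiFactors.exists_smul_of_eq {X Y : C} {d e : ℕ} {r : 𝒜 d} {b : 𝒜 e} {i : ℤ}
    (h : α.PhiFactors r b (Y⟦i⟧)) (f : X ⟶ Y⟦i⟧) {k : ℤ} (hk : (d : ℤ) + k = e + i) :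
    ∃ w : X ⟶ Y⟦k⟧, (b : R) • α.of X Y i f = (r : R) • α.of X Y k w := by
  obtain ⟨V, u, ι, h⟩ := h
  rw [smul_of_eq, h]
  generalize signedShiftAdd Y rfl = τ
  generalize (e : ℤ) + i = l at hk τ
  subst hk
  simpa only [Category.assoc] using α.exists_of_eq_smul_of r (f ≫ u) (ι ≫ τ.hom)

lemma mem_annihilator_homGE_iff_kills [IsGradedCommutative 𝒜] {X Y : C} {n : ℤ} {e : ℕ}
    {a : evenSubring 𝒜} (ha : a ∈ evenGrading 𝒜 e) :
    a ∈ Module.annihilator (evenSubring 𝒜) (α.homGE X Y n) ↔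
      ∀ i, n ≤ i → α.Kills (⟨a, ha⟩ : 𝒜 e) X (Y⟦i⟧) := by
  rw [mem_annihilator_homGE]
  exact forall₃_congr fun i _ g => α.smul_of_eq_zero_iff (⟨a, ha⟩ : 𝒜 e) g

end Preadditive

section Triangulated

variable {C : Type u} [Category.{v} C] [Preadditive C] [HasZeroObject C] [HasShift C ℤ]
  [∀ n : ℤ, (shiftFunctor C n).Additive] [Pretriangulated C]

lemma exists_lift_shift_mor₂ {T : Triangle C} (hT : T ∈ distTriang C) (n : ℤ) {Y : C}
    (g : Y ⟶ T.obj₃⟦n⟧) (hg : g ≫ T.mor₃⟦n⟧' = 0) :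
    ∃ u : Y ⟶ T.obj₂⟦n⟧, g = u ≫ T.mor₂⟦n⟧' := by
  obtain ⟨(u : Y ⟶ T.obj₂⟦n⟧), (hu : g = u ≫ (n.negOnePow • T.mor₂⟦n⟧'))⟩ :=
    Triangle.coyoneda_exact₃ _ (Triangle.shift_distinguished _ hT n) g (by
    change g ≫ (n.negOnePow • (T.mor₃⟦n⟧' ≫ (shiftFunctorComm C 1 n).hom.app T.obj₁)) = 0
    rw [Linear.comp_units_smul, reassoc_of% hg, zero_comp, smul_zero])
  refine ⟨n.negOnePow • u, ?_⟩
  rw [hu, Linear.comp_units_smul, Linear.units_smul_comp]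

lemma exists_lift_shift_mor₁ {T : Triangle C} (hT : T ∈ distTriang C) (n : ℤ) {Y : C}
    (g : Y ⟶ T.obj₂⟦n⟧) (hg : g ≫ T.mor₂⟦n⟧' = 0) :
    ∃ u : Y ⟶ T.obj₁⟦n⟧, g = u ≫ T.mor₁⟦n⟧' := by
  obtain ⟨(u : Y ⟶ T.obj₁⟦n⟧), (hu : g = u ≫ (n.negOnePow • T.mor₁⟦n⟧'))⟩ :=
    Triangle.coyoneda_exact₂ _ (Triangle.shift_distinguished _ hT n) g (by
    change g ≫ (n.negOnePow • T.mor₂⟦n⟧') = 0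
    rw [Linear.comp_units_smul, hg, smul_zero])
  refine ⟨n.negOnePow • u, ?_⟩
  rw [hu, Linear.comp_units_smul, Linear.units_smul_comp]

variable {R : Type w} [Ring R] {𝒜 : ℕ → AddSubgroup R} [GradedRing 𝒜] {α : CentralAction C 𝒜}

lemma Kills.cone_target {T : Triangle C} (hT : T ∈ distTriang C) {m n : ℕ} {a : 𝒜 m} {b : 𝒜 n}
    {Y : C} (h₁ : α.Kills b Y (T.obj₁⟦(1 : ℤ)⟧)) (h₂ : α.Kills a Y (T.obj₂⟦(n : ℤ)⟧)) :
    α.Kills (hmul a b) Y T.obj₃ := by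
  refine kills_hmul_iff.mpr fun g => ?_
  obtain ⟨u, hu⟩ := exists_lift_shift_mor₂ hT (n : ℤ) (g ≫ α.phi T.obj₃ b) (by
    rw [Category.assoc, ← α.phi_naturality, ← Category.assoc]
    exact h₁ _)
  rw [← Category.assoc, hu, Category.assoc, α.phi_naturality, reassoc_of% (h₂ u), zero_comp]

lemma Kills.cone_source {T : Triangle C} (hT : T ∈ distTriang C) {m n : ℕ} {a : 𝒜 m} {b : 𝒜 n}
    {Z : C} (h₂ : α.Kills b T.obj₂ Z) (h₁ : α.Kills a (T.obj₁⟦(1 : ℤ)⟧) (Z⟦(n : ℤ)⟧)) :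
    α.Kills (hmul a b) T.obj₃ Z := by
  refine kills_hmul_iff.mpr fun g => ?_
  obtain ⟨u, hu⟩ := Triangle.yoneda_exact₃ _ hT (g ≫ α.phi Z b) (by
    rw [← Category.assoc]
    exact h₂ _)
  rw [← Category.assoc, hu, Category.assoc, h₁ u, comp_zero]

section Koszul

variable {X K : C} {d : ℕ} {r : 𝒜 d}

lemma exists_isKoszulObject (α : CentralAction C 𝒜) (X : C) (r : 𝒜 d) :
    ∃ K : C, α.IsKoszulObject X r K :=
  let ⟨K, g, h, hT⟩ := distinguished_cocone_triangle (α.phi X r)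
  ⟨K, g, h, hT⟩

lemma IsKoszulObject.kills_pow_four (hK : α.IsKoszulObject X r K) {e : ℕ} {a : 𝒜 e} {n : ℤ}
    (h : ∀ i, n ≤ i → α.Kills a X (X⟦i⟧)) {i : ℤ} (hi : n + d + 1 ≤ i) :
    α.Kills (hmul (hmul a a) (hmul a a)) K (K⟦i⟧) := by
  obtain ⟨g, k, hT⟩ := hK
  have hXK (i : ℤ) (hi : n ≤ i) : α.Kills (hmul a a) X (K⟦i⟧) := by
    refine Kills.cone_target (Triangle.shift_distinguished _ hT i) ?_ ?_
    · exact (h (i + 1) (by omega)).of_iso (shiftShiftIso X rfl).symm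
    · exact (h (d + i + e) (by omega)).of_iso
        ((shiftFunctor C (e : ℤ)).mapIso (shiftShiftIso X rfl) ≪≫ shiftShiftIso X rfl).symm
  refine Kills.cone_source hT ?_ ?_
  · exact ((hXK (i - d) (by omega)).shift d).of_iso (shiftShiftIso K (by omega))
  · exact ((hXK (i + ((e + e : ℕ) : ℤ) - 1) (by omega)).shift 1).of_iso
      (shiftShiftIso K (by omega) ≪≫ (shiftShiftIso K rfl).symm)

lemma IsKoszulObject.phi_comp_phi (hK : α.IsKoszulObject X r K) :
    α.phi K r ≫ α.phi (K⟦(d : ℤ)⟧) r = 0 := by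
  obtain ⟨g, k, hT⟩ := hK
  have h31 : k ≫ (α.phi X r)⟦(1 : ℤ)⟧' = 0 := comp_distTriang_mor_zero₃₁ _ hT
  have h12 : α.phi X r ≫ g = 0 := comp_distTriang_mor_zero₁₂ _ hT
  obtain ⟨(u : K ⟶ X⟦(d : ℤ)⟧⟦(d : ℤ)⟧), (hu : α.phi K r = u ≫ g⟦(d : ℤ)⟧')⟩ :=
    exists_lift_shift_mor₂ hT (d : ℤ) (α.phi K r) (by
    change α.phi K r ≫ k⟦(d : ℤ)⟧' = 0
    rw [← α.phi_naturality, phi_shift, reassoc_of% h31, zero_comp])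
  have hg : g ≫ α.phi K r = 0 := by
    rw [α.phi_naturality, phi_shift_self, Linear.units_smul_comp, ← Functor.map_comp, h12,
      Functor.map_zero, smul_zero]
  conv_lhs => rw [hu, Category.assoc, phi_shift, ← Functor.map_comp_assoc, hg]
  simp

lemma IsKoszulObject.kills_sq (hK : α.IsKoszulObject X r K) (Z : C) : α.Kills (hmul r r) K Z := by
  refine kills_hmul_iff.mpr fun g => ?_
  rw [α.phi_naturality_assoc g, α.phi_naturality (g⟦(d : ℤ)⟧'), ← Category.assoc,
    hK.phi_comp_phi, zero_comp]

lemma IsKoszulObject.phiFactors_of_phi_eq_zero (hK : α.IsKoszulObject X r K) {e : ℕ} {b : 𝒜 e}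
    (hb : α.phi K b = 0) (i : ℤ) : α.PhiFactors r b (X⟦i⟧) := by
  obtain ⟨g, k, hT⟩ := hK
  obtain ⟨(u : X⟦(d : ℤ)⟧ ⟶ X⟦(e : ℤ)⟧),
      (hu : α.phi (X⟦(d : ℤ)⟧) b = u ≫ (α.phi X r)⟦(e : ℤ)⟧')⟩ :=
    exists_lift_shift_mor₁ hT (e : ℤ) (α.phi (X⟦(d : ℤ)⟧) b) (by
    change α.phi (X⟦(d : ℤ)⟧) b ≫ g⟦(e : ℤ)⟧' = 0
    rw [← α.phi_naturality, hb, comp_zero])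
  have h : α.PhiFactors r b (X⟦(d : ℤ)⟧) :=
    ⟨X⟦(e : ℤ)⟧, u, (signedShiftComm X d e).inv, by rw [hu, shift_phi]⟩
  exact (h.shift (i - d)).of_iso (shiftShiftIso X (by omega))

end Koszul

end Triangulated

end CentralAction

/-! ### Complexity of Koszul objects -/

lemma unbotD_zero_mono {a b : WithBot ℕ∞} (h : a ≤ b) : a.unbotD 0 ≤ b.unbotD 0 := by
  rcases eq_or_ne a ⊥ with rfl | ha
  · exact zero_le
  · exact WithBot.unbotD_mono ha h

lemma unbotD_zero_ne_top {a : WithBot ℕ∞} (h : a ≠ ⊤) : a.unbotD 0 ≠ ⊤ := by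
  cases a with
  | bot => exact ENat.zero_ne_top
  | coe a => exact fun ha => h (congrArg _ ha)

lemma one_le_of_unbotD_zero_ne_zero {a : WithBot ℕ∞} (h : a.unbotD 0 ≠ 0) : 1 ≤ a := by
  cases a with
  | bot => exact absurd rfl h
  | coe a => exact WithBot.coe_le_coe.mpr (Order.one_le_iff_ne_zero.mpr h)

lemma unbotD_zero_add_one_sub_one (a : WithBot ℕ∞) : (a + 1).unbotD 0 - 1 = a.unbotD 0 := by
  cases a with
  | bot => exact zero_tsub 1
  | coe a => exact (ENat.addLECancellable_of_ne_top ENat.one_ne_top).add_tsub_cancel_right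

namespace CentralAction

section Complexity

open Module

variable {C : Type u} [Category.{v} C] [Preadditive C] [HasShift C ℤ]
  [∀ n : ℤ, (shiftFunctor C n).Additive]
  {R : Type w} [Ring R] {𝒜 : ℕ → AddSubgroup R} [GradedRing 𝒜] [IsGradedCommutative 𝒜]
  (α : CentralAction C 𝒜)

lemma supportDim_homGE_anti (X Y : C) :
    Antitone fun n => supportDim (evenSubring 𝒜) (α.homGE X Y n) := fun _ _ h =>
  supportDim_le_of_injective
    ((Submodule.inclusion (α.homGE_anti X Y h)).restrictScalars (evenSubring 𝒜))
    (Submodule.inclusion_injective (α.homGE_anti X Y h))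

lemma exists_forall_cxPair_eq (X Y : C) : ∃ m : ℤ, ∀ n, m ≤ n →
    α.cxPair X Y = (supportDim (evenSubring 𝒜) (α.homGE X Y n)).unbotD 0 := by
  obtain ⟨m, hm⟩ : α.cxPair X Y ∈ Set.range fun n : ℤ =>
    (supportDim (evenSubring 𝒜) (α.homGE X Y n)).unbotD 0 :=
    csInf_mem (Set.range_nonempty _)
  refine ⟨m, fun n hn => (iInf_le _ n).antisymm ?_⟩
  refine le_of_le_of_eq ?_ hm
  exact unbotD_zero_mono (α.supportDim_homGE_anti X Y hn)

end Complexity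

section Koszul

open Module

variable {C : Type u} [Category.{v} C] [Preadditive C] [HasZeroObject C] [HasShift C ℤ]
  [∀ n : ℤ, (shiftFunctor C n).Additive] [Pretriangulated C]
  {R : Type w} [Ring R] {𝒜 : ℕ → AddSubgroup R} [GradedRing 𝒜] [IsGradedCommutative 𝒜]
  {α : CentralAction C 𝒜} {X K : C} {d : ℕ} {r : evenSubring 𝒜} {hr : r ∈ evenGrading 𝒜 d}
  (hK : α.IsKoszulObject X (⟨r, hr⟩ : 𝒜 d) K) {n : ℤ}

include hK

lemma IsKoszulObject.mul_self_mem_annihilator (m : ℤ) :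
    r * r ∈ annihilator (evenSubring 𝒜) (α.homGE K K m) :=
  (mem_annihilator_homGE_iff_kills (SetLike.mul_mem_graded hr hr)).mpr fun _ _ => hK.kills_sq _

lemma IsKoszulObject.mul_mul_mem_annihilator {e : ℕ} {a : evenSubring 𝒜}
    (ha : a ∈ evenGrading 𝒜 e) (h : a ∈ annihilator (evenSubring 𝒜) (α.homGE X X n)) {m : ℤ}
    (hm : n + d + 1 ≤ m) : a * a * (a * a) ∈ annihilator (evenSubring 𝒜) (α.homGE K K m) := by
  have haa := SetLike.mul_mem_graded ha ha
  rw [mem_annihilator_homGE_iff_kills ha] at h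
  exact (mem_annihilator_homGE_iff_kills (SetLike.mul_mem_graded haa haa)).mpr fun i hi =>
    hK.kills_pow_four h (hm.trans hi)

lemma IsKoszulObject.mem_annihilator_quotSMulTop {e : ℕ} (he : d ≤ e) {b : evenSubring 𝒜}
    (hb : b ∈ evenGrading 𝒜 e) (hbK : α.phi K (⟨b, hb⟩ : 𝒜 e) = 0) :
    b ∈ annihilator (evenSubring 𝒜) (QuotSMulTop r (α.homGE X X n)) := by
  rw [mem_annihilator]
  intro z
  obtain ⟨⟨f, hf⟩, rfl⟩ := Submodule.Quotient.mk_surjective _ z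
  obtain ⟨w, hw, hbw⟩ : ∃ w ∈ α.homGE X X n, b • f = r • w := by
    refine α.homGE_induction (motive := fun f => ∃ w ∈ α.homGE X X n, b • f = r • w)
      (fun i hi g => ?_) (fun f g => ?_) hf
    · obtain ⟨w, hw⟩ := (hK.phiFactors_of_phi_eq_zero hbK i).exists_smul_of_eq g
        (k := e + i - d) (by omega)
      exact ⟨_, α.of_mem_homGE (by omega) w, hw⟩
    · rintro ⟨w, hw, hbw⟩ ⟨w', hw', hbw'⟩
      exact ⟨w + w', add_mem hw hw', by rw [smul_add, smul_add, hbw, hbw']⟩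
  rw [← Submodule.Quotient.mk_smul, Submodule.Quotient.mk_eq_zero]
  exact Subtype.ext (a1 := b • ⟨f, hf⟩) (a2 := r • ⟨w, hw⟩) hbw ▸
    Submodule.smul_mem_pointwise_smul _ _ _ Submodule.mem_top

lemma IsKoszulObject.mem_support {p : PrimeSpectrum (evenSubring 𝒜)}
    (hp : p ∈ support (evenSubring 𝒜) (QuotSMulTop r (α.homGE X X n)))
    (hirr : ¬ (HomogeneousIdeal.irrelevant (evenGrading 𝒜)).toIdeal ≤ p.asIdeal) (m : ℤ) :
    p ∈ support (evenSubring 𝒜) (α.homGE K K m) := by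
  obtain ⟨l, hl, s, hs, hsp⟩ := exists_homogeneous_notMem_of_degree_ge _ hirr (max d m.toNat)
  let f := α.of K K l (α.phi K (⟨s, hs⟩ : 𝒜 l))
  have hf : f ∈ α.homGE K K m := α.of_mem_homGE (by omega) _
  have hann : (Submodule.span (evenSubring 𝒜) {(⟨f, hf⟩ : α.homGE K K m)}).annihilator =
      Ideal.torsionOf (evenSubring 𝒜) (α.HomStar K K) f := by
    ext a
    rw [Submodule.mem_annihilator_span_singleton, Ideal.mem_torsionOf_iff]
    exact Subtype.ext_iff
  rw [mem_support_iff_exists_annihilator]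
  refine ⟨⟨f, hf⟩, ?_⟩
  rw [hann]
  by_contra hle
  obtain ⟨e, b, hb, hbs, hbp⟩ :=
    exists_homogeneous_mem_notMem (α.isHomogeneous_torsionOf_of _) hle
  have hbsK : α.phi K (hmul (⟨b, hb⟩ : 𝒜 e) (⟨s, hs⟩ : 𝒜 l)) = 0 :=
    (α.phi_hmul_eq_zero_iff _ _).mpr hbs
  exact (p.isPrime.mul_mem_iff_mem_or_mem.mp (annihilator_le_of_mem_support hp
    (hK.mem_annihilator_quotSMulTop (by omega) (SetLike.mul_mem_graded hb hs) hbsK))).elim hbp hsp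

variable [Module.Finite (evenSubring 𝒜) (α.homGE X X n)]

lemma IsKoszulObject.support_subset {m : ℤ} (hm : n + d + 1 ≤ m) :
    support (evenSubring 𝒜) (α.homGE K K m) ⊆
      support (evenSubring 𝒜) (QuotSMulTop r (α.homGE X X n)) := by
  intro p hp
  have hann := annihilator_le_of_mem_support hp
  rw [support_quotSMulTop, support_eq_zeroLocus]
  refine ⟨?_, Set.singleton_subset_iff.mpr
    (or_self_iff.mp (p.isPrime.mem_or_mem (hann (hK.mul_self_mem_annihilator m))))⟩
  by_contra hle
  obtain ⟨e, a, ha, haX, hap⟩ :=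
    exists_homogeneous_mem_notMem (α.homGEAnnihilator X X n).isHomogeneous hle
  have hmem := hann (hK.mul_mul_mem_annihilator ha haX hm)
  exact hap (or_self_iff.mp (p.isPrime.mem_or_mem (or_self_iff.mp (p.isPrime.mem_or_mem hmem))))

lemma IsKoszulObject.cx_eq
    [Ring.KrullDimLE 0 (quotientGrading (evenGrading 𝒜) (α.homGEAnnihilator X X n).toIdeal 0)] :
    α.cx K = (supportDim (evenSubring 𝒜) (QuotSMulTop r (α.homGE X X n))).unbotD 0 := by
  refine le_antisymm ?_ (le_iInf fun m => ?_)
  · refine (iInf_le _ (n + d + 1)).trans (unbotD_zero_mono ?_)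
    exact Order.krullDim_le_of_strictMono (Set.inclusion (hK.support_subset le_rfl)) fun _ _ h => h
  · refine unbotD_krullDim_le_of_forall_isMax_or_mem (fun p q => mem_support_mono) fun p hp => ?_
    by_cases hirr : (HomogeneousIdeal.irrelevant (evenGrading 𝒜)).toIdeal ≤ p.asIdeal
    · rw [support_quotSMulTop, support_eq_zeroLocus] at hp
      exact .inl (PrimeSpectrum.isMax_iff.mpr (isMaximal_of_annihilator_le_of_irrelevant_le
        (I := α.homGEAnnihilator X X n) rfl hp.1 hirr))
    · exact .inr (hK.mem_support hp hirr m)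

end Koszul

end CentralAction

theorem mainTheorem6_general {C : Type u} [Category.{v} C] [Preadditive C] [HasZeroObject C]
    [HasShift C ℤ] [∀ n : ℤ, (shiftFunctor C n).Additive] [Pretriangulated C]
    {R : Type w} [Ring R] (𝒜 : ℕ → AddSubgroup R) [GradedRing 𝒜] [IsGradedCommutative 𝒜]
    (α : CentralAction C 𝒜) (X : C)
    (hX : α.EventuallyNoetherianFL X X) (hcx : α.cx X ≠ 0) :
    α.cx X ≠ ⊤ ∧
      ∃ (d : ℕ) (r : 𝒜 d), 0 < d ∧
        (∃ K : C, α.IsKoszulObject X r K) ∧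
        ∀ K : C, α.IsKoszulObject X r K → α.cx K = α.cx X - 1 := by
  obtain ⟨⟨n₁, hnoeth⟩, n₂, hlen⟩ := hX
  obtain ⟨n₃, hcx_eq⟩ := α.exists_forall_cxPair_eq X X
  obtain ⟨n, h₁, h₂, h₃⟩ : ∃ n, n₁ ≤ n ∧ n₂ ≤ n ∧ n₃ ≤ n :=
    ⟨max n₁ (max n₂ n₃), by omega, by omega, by omega⟩
  have hcxX : α.cx X = (Module.supportDim (evenSubring 𝒜) (α.homGE X X n)).unbotD 0 := hcx_eq n h₃
  have : IsNoetherian R (α.homGE X X n) := isNoetherian_of_le (α.homGE_anti X X h₁)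
  have := α.isNoetherian_evenSubring_homGE X X n
  have := α.krullDimLE_zero_quotientGrading_homGEAnnihilator (X := X) (Y := X) (n := n)
    fun i hi => hlen i (h₂.trans hi)
  have hann : (α.homGEAnnihilator X X n).toIdeal =
    Module.annihilator (evenSubring 𝒜) (α.homGE X X n) := rfl
  refine ⟨hcxX ▸ unbotD_zero_ne_top (supportDim_ne_top_of_gradedRing hann), ?_⟩
  obtain ⟨d, hd, r, hr, hdrop⟩ := exists_homogeneous_supportDim_quotSMulTop_add_one_eq hann
    (one_le_of_unbotD_zero_ne_zero (hcxX ▸ hcx))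
  refine ⟨d, ⟨r, hr⟩, hd, CentralAction.exists_isKoszulObject α X _, fun K hK => ?_⟩
  rw [hK.cx_eq (n := n), hcxX, ← hdrop, unbotD_zero_add_one_sub_one]

end

theorem mainTheorem6 {C : Type u} [Category.{v} C] [Preadditive C] [HasZeroObject C]
    [HasShift C ℤ] [∀ n : ℤ, (shiftFunctor C n).Additive] [Pretriangulated C] [IsTriangulated C]
    {R : Type w} [Ring R] (𝒜 : ℕ → AddSubgroup R) [GradedRing 𝒜] [IsGradedCommutative 𝒜]
    (α : CentralAction C 𝒜) (X : C)
    (hX : α.EventuallyNoetherianFL X X) (hcx : α.cx X ≠ 0) :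
    α.cx X ≠ ⊤ ∧
      ∃ (d : ℕ) (r : 𝒜 d), 0 < d ∧
        (∃ K : C, α.IsKoszulObject X r K) ∧
        ∀ K : C, α.IsKoszulObject X r K → α.cx K = α.cx X - 1 :=
  mainTheorem6_general 𝒜 α X hX hcx
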